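/- Let $n \ge 1$ and let $X = (X_1,\dots,X_n)$ be a (not necessarily centered, possibly degenerate) Gaussian random field, that is, real random variables on a common probability space such that every finite subcollection has a multivariate normal law. Let $\sigma_i \ge 0$ with $\mathrm{Var}(X_i) = \sigma_i^2$ for $1 \le i \le n$, let $\sigma_{(1)} \le \dots \le \sigma_{(n)}$ be the ordered values of $\sigma_1,\dots,\sigma_n$, and put $Z_n = \max_{1\le i\le n} X_i$. For a real random variable $Z$ and $\varepsilon>0$ let $Q(Z,\varepsilon) = \sup_{t\in\mathbb{R}} \mathbb{P}\{t \le Z \le t+\varepsilon\}$. Set $$\bar\sigma_n = \frac{2+\sqrt{2\log n}}{\dfrac{1}{\sigma_{(1)}} + \max_{1\le k\le n} \dfrac{1+\sqrt{2\log k}}{\sigma_{(k)}}},$$ where $\bar\sigma_n = 0$ if $\sigma_{(1)} = 0$ (the convention $1/0=\infty$). Then, for all $\varepsilon > 0$, $$\frac{\varepsilon/\sqrt{12}}{\sqrt{\sigma_{(n)}^2+\varepsilon^2/12}} \;\le\; Q(Z_n,\varepsilon) \;\le\; \frac{12\,(2+\sqrt{2\log n})\,\varepsilon}{\sqrt{\bar\sigma_n^2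 + (2+\sqrt{2\log n})^2\varepsilon^2}},$$ and moreover $\bar\sigma_n \ge \sigma_{(1)}$. -/

import Mathlib

open MeasureTheory ProbabilityTheory

noncomputable section

/-- The Lévy concentration function
`Q(Z, ε) = sup_{t ∈ ℝ} P (t ≤ Z ≤ t + ε)` of a real random variable `Z`. -/
def concentrationFunction {Ω : Type*} [MeasurableSpace Ω] (P : Measure Ω) (Z : Ω → ℝ)
    (ε : ℝ) : ℝ :=
  ⨆ t : ℝ, P.real {ω | t ≤ Z ω ∧ Z ω ≤ t + ε}

/-- `orderedValue σ k` is the entry at (zero-based) position `k` when the values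
`σ 0, …, σ (n - 1)` are listed in non-decreasing order, with repetitions. So it is the
`(k + 1)`-th smallest value; position `0` holds the minimum and `⊤` the maximum. -/
def orderedValue {n : ℕ} (σ : Fin n → ℝ) (k : Fin n) : ℝ :=
  σ (Tuple.sort σ k)

/-- The maximum `max_i X_i` of finitely many (at least one) random variables. -/
def fieldMax {Ω : Type*} {n : ℕ} [NeZero n] (X : Fin n → Ω → ℝ) (ω : Ω) : ℝ :=
  Finset.univ.sup' Finset.univ_nonempty (fun i => X i ω)

/-- The averaged standard deviation
`(2 + √(2 log n)) / (1 / σ_(1) + max_{1 ≤ k ≤ n} (1 + √(2 log k)) / σ_(k))`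
of nonnegative numbers `σ_1, …, σ_n`. If the smallest value `σ_(1)` vanishes, the denominator
is infinite (`1 / 0 = ∞`) and the quotient is `0`. -/
def sigmaBar {n : ℕ} [NeZero n] (σ : Fin n → ℝ) : ℝ :=
  if orderedValue σ 0 = 0 then 0
  else
    (2 + √(2 * Real.log n)) /
      (1 / orderedValue σ 0 +
        Finset.univ.sup' Finset.univ_nonempty
          (fun k : Fin n => (1 + √(2 * Real.log ((k : ℕ) + 1 : ℝ))) / orderedValue σ k))

end

open MeasureTheory ProbabilityTheory

/-! The two bounds are independent of each other.

Lower bound. A law of small variance must concentrate (`le_mul_sqrt_variance_add`): averaging the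
masses of intervals of length `ε` against a parabolic weight around the mean gives `ε ≤ √12 * Q *
√(Var Z + ε² / 12)`. The maximum satisfies `Var Z ≤ σ_(n)²` by the Gaussian Poincaré inequality: as
a function of a standard Gaussian vector, it is a maximum of affine maps whose linear parts have
norms `σ_i`, so its gradient has norm at most `σ_(n)` almost everywhere.

Upper bound. Normalise to `Y_i = (X_i - t) / σ_i`. If `t ≤ Z ≤ t + ε`, then the index `i` where `Y`
is maximal has `0 ≤ Y_i ≤ ε / σ_i`. Regression on `Y_i` leaves residuals independent of it, with
coefficients at most `1`; given the residuals, "`i` is the argmax" is therefore an upper set in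
`Y_i`. A Mills-type bound then controls the term of `i` by its argmax probability times `(ε / σ_i)(1
+ h)`, up to a constant, where `h` is essentially `-E Y_i` (`measureReal_argmaxEvent_inter_le`). At
rank `k` this is used when `h ≤ 2√(log k)`, and the argmax probabilities sum to at most `1`. For
larger `h` the density alone is at most `k⁻² / 2`, which is summable. The total is at most `11 ε (1
/ σ_(1) + max_k (1 + √(2 log k)) / σ_(k))`. -/

/-! ### The Gaussian Poincaré inequality on the line -/

lemma hasDerivAt_gaussianPDFReal_zero_one (x : ℝ) :
    HasDerivAt (gaussianPDFReal 0 1) (-(x * gaussianPDFReal 0 1 x)) x := by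
  have h : HasDerivAt (fun x : ℝ ↦ -(x - 0) ^ 2 / (2 * ((1 : NNReal) : ℝ))) (-x) x := by
    have := (((hasDerivAt_id x).sub_const 0).pow 2).neg.div_const (2 * ((1 : NNReal) : ℝ))
    refine this.congr_deriv ?_
    simp
    ring
  refine (h.exp.const_mul ((√(2 * Real.pi * ((1 : NNReal) : ℝ)))⁻¹)).congr_deriv ?_
  rw [gaussianPDFReal]
  ring

lemma tendsto_gaussianPDFReal_atTop :
    Filter.Tendsto (gaussianPDFReal 0 1) Filter.atTop (nhds 0) := by
  have h : Filter.Tendsto (fun x : ℝ ↦ -(x - 0) ^ 2 / (2 * ((1 : NNReal) : ℝ))) Filter.atTop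
      Filter.atBot := by
    have : Filter.Tendsto (fun x : ℝ ↦ x ^ 2) Filter.atTop Filter.atTop :=
      Filter.tendsto_pow_atTop two_ne_zero
    have h2 := (this.atTop_div_const (show (0 : ℝ) < 2 by norm_num))
    have h3 := Filter.tendsto_neg_atTop_atBot.comp h2
    refine h3.congr fun x ↦ ?_
    simp; ring
  have := (Real.tendsto_exp_atBot.comp h).const_mul ((√(2 * Real.pi * ((1 : NNReal) : ℝ)))⁻¹)
  simpa [gaussianPDFReal_def, Function.comp_def] using this

lemma integrable_id_gaussianReal : Integrable (fun x : ℝ ↦ x) (gaussianReal 0 1) :=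
  (IsGaussian.integrable_id (μ := gaussianReal 0 1))

lemma integrable_mul_gaussianPDFReal : Integrable (fun x : ℝ ↦ x * gaussianPDFReal 0 1 x) := by
  have h := integrable_id_gaussianReal
  rw [gaussianReal_of_var_ne_zero _ one_ne_zero,
    integrable_withDensity_iff_integrable_smul' (measurable_gaussianPDF 0 1)
    (by simp [gaussianPDF])] at h
  refine h.congr (ae_of_all _ fun x ↦ ?_)
  simp [gaussianPDF, ENNReal.toReal_ofReal (gaussianPDFReal_nonneg 0 1 x), mul_comm]

lemma setIntegral_gaussianReal_eq (s : Set ℝ) (hs : MeasurableSet s) (f : ℝ → ℝ) :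
    ∫ x in s, f x ∂(gaussianReal 0 1) = ∫ x in s, f x * gaussianPDFReal 0 1 x := by
  rw [← integral_indicator hs, integral_gaussianReal_eq_integral_smul one_ne_zero,
    ← integral_indicator hs]
  congr with x
  by_cases h : x ∈ s <;> simp [h, mul_comm]

lemma setIntegral_Ici_id_gaussianReal (s : ℝ) :
    ∫ x in Set.Ici s, x ∂(gaussianReal 0 1) = gaussianPDFReal 0 1 s := by
  rw [setIntegral_gaussianReal_eq _ measurableSet_Ici, integral_Ici_eq_integral_Ioi]
  have := integral_Ioi_of_hasDerivAt_of_tendsto' (a := s) (f := fun x ↦ -gaussianPDFReal 0 1 x)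
    (f' := fun x ↦ x * gaussianPDFReal 0 1 x) (m := 0)
    (fun x _ ↦ by simpa using (hasDerivAt_gaussianPDFReal_zero_one x).fun_neg)
    integrable_mul_gaussianPDFReal.integrableOn
    (by simpa using tendsto_gaussianPDFReal_atTop.neg)
  simpa using this

lemma setIntegral_Iio_id_gaussianReal (s : ℝ) :
    ∫ x in Set.Iio s, x ∂(gaussianReal 0 1) = -gaussianPDFReal 0 1 s := by
  have h := integral_add_compl (measurableSet_Ici (a := s)) integrable_id_gaussianReal
  rw [Set.compl_Ici, setIntegral_Ici_id_gaussianReal, integral_id_gaussianReal] at h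
  linarith

/-- The constraint `y < s ≤ x` is a product set, and each first moment over a half-line is `±φ(s)`.
The integral is thus `φ(s) γ(Iio s) + φ(s) γ(Ici s) = φ(s)`. This identity makes the Poincaré
constant equal to `1`. -/
lemma lintegral_lintegral_sub_gaussianReal (s : ℝ) :
    ∫⁻ x, ∫⁻ y, (Set.Ioc y x).indicator (fun _ ↦ ENNReal.ofReal (x - y)) s
      ∂(gaussianReal 0 1) ∂(gaussianReal 0 1) = gaussianPDF 0 1 s := by
  set γ := gaussianReal 0 1
  have hint : Integrable (fun p : ℝ × ℝ ↦ p.1 - p.2) (γ.prod γ) :=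
    (integrable_id_gaussianReal.comp_fst γ).sub (integrable_id_gaussianReal.comp_snd γ)
  have hm : MeasurableSet (Set.Ici s ×ˢ Set.Iio s) := measurableSet_Ici.prod measurableSet_Iio
  have h1 : ∫ p in Set.Ici s ×ˢ Set.Iio s, (p.1 - p.2) ∂(γ.prod γ) = gaussianPDFReal 0 1 s := by
    rw [setIntegral_prod _ hint.integrableOn]
    have : ∀ x : ℝ, ∫ y in Set.Iio s, (x - y) ∂γ
        = x * γ.real (Set.Iio s) + gaussianPDFReal 0 1 s := by
      intro x
      rw [integral_sub (integrable_const _).integrableOn integrable_id_gaussianReal.integrableOn,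
        setIntegral_Iio_id_gaussianReal]
      simp [γ, mul_comm]
    simp only [this]
    rw [integral_add (integrable_id_gaussianReal.integrableOn.mul_const _)
      (integrable_const _).integrableOn, integral_mul_const, setIntegral_Ici_id_gaussianReal]
    have h2 : γ.real (Set.Ici s) = 1 - γ.real (Set.Iio s) := by
      rw [← Set.compl_Iio, probReal_compl_eq_one_sub measurableSet_Iio]
    simp only [γ] at h2
    simp only [γ, integral_const, measureReal_restrict_apply_univ, h2, smul_eq_mul]
    ring
  rw [gaussianPDF, ← h1, ofReal_integral_eq_lintegral_ofReal hint.integrableOn,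
    ← lintegral_indicator hm, lintegral_prod]
  · congr with x
    congr with y
    simp [Set.indicator, and_comm]
  · exact (Measurable.indicator (by fun_prop) hm).aemeasurable
  · rw [Filter.EventuallyLE, ae_restrict_iff' hm]
    refine ae_of_all _ fun p hp ↦ ?_
    simp at hp ⊢
    linarith [hp.1, hp.2]

lemma LipschitzWith.abs_deriv_le {C : NNReal} {f : ℝ → ℝ} (hf : LipschitzWith C f) (x : ℝ) :
    |deriv f x| ≤ C := by
  simpa using norm_deriv_le_of_lipschitz hf (x₀ := x)

/-- Cauchy–Schwarz for the increment `∫ f'`, valid because Lipschitz functions are absolutely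
continuous; it follows from `∫ (f' - c)² ≥ 0` with `c` the mean slope. -/
lemma LipschitzWith.sq_sub_le_mul_integral {C : NNReal} {f : ℝ → ℝ} (hf : LipschitzWith C f)
    {x y : ℝ} (h : y ≤ x) : (f x - f y) ^ 2 ≤ (x - y) * ∫ s in y..x, deriv f s ^ 2 := by
  have hm : Measurable (deriv f) := measurable_deriv f
  have hi : ∀ g : ℝ → ℝ, Measurable g → (∃ B, ∀ x, |g x| ≤ B) → IntervalIntegrable g volume y x := by
    rintro g hg ⟨B, hB⟩
    rw [intervalIntegrable_iff]
    exact Measure.integrableOn_of_bounded (by simp) hg.aestronglyMeasurable (M := B)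
      (ae_of_all _ hB)
  have h1 := hi (deriv f) hm ⟨C, hf.abs_deriv_le⟩
  have h2 := hi (fun x ↦ deriv f x ^ 2) (hm.pow_const 2) ⟨C ^ 2, fun x ↦ by
    rw [abs_pow]; gcongr; exact hf.abs_deriv_le x⟩
  have hF : ∫ s in y..x, deriv f s = f x - f y :=
    (hf.lipschitzOnWith.absolutelyContinuousOnInterval).integral_deriv_eq_sub
  rcases h.eq_or_lt with rfl | hlt
  · simp
  set c := (f x - f y) / (x - y)
  have h3 : 0 ≤ ∫ s in y..x, (deriv f s - c) ^ 2 :=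
    intervalIntegral.integral_nonneg h fun s _ ↦ sq_nonneg _
  have h4 : ∫ s in y..x, (deriv f s - c) ^ 2
      = (∫ s in y..x, deriv f s ^ 2) - 2 * c * (f x - f y) + c ^ 2 * (x - y) := by
    rw [← hF, ← intervalIntegral.integral_const_mul]
    have : ∀ s, (deriv f s - c) ^ 2 = deriv f s ^ 2 - 2 * c * deriv f s + c ^ 2 := fun s ↦ by ring
    simp only [this]
    rw [intervalIntegral.integral_add (h2.sub (h1.const_mul _)) (by simp),
      intervalIntegral.integral_sub h2 (h1.const_mul _)]
    simp [mul_comm]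
  have hxy : 0 < x - y := sub_pos.2 hlt
  have hc : c * (x - y) = f x - f y := div_mul_cancel₀ _ hxy.ne'
  rw [h4, ← hc] at h3
  rw [← hc]
  nlinarith

lemma LipschitzWith.memLp_of_isGaussian {E : Type*} [NormedAddCommGroup E] [NormedSpace ℝ E]
    [CompleteSpace E] [SecondCountableTopology E] [MeasurableSpace E] [BorelSpace E]
    {C : NNReal} {f : E → ℝ} (hf : LipschitzWith C f) (μ : Measure E) [IsGaussian μ] :
    MemLp f 2 μ := by
  have h : MemLp (fun x : E ↦ C * ‖x‖ + |f 0|) 2 μ :=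
    ((IsGaussian.memLp_two_id (μ := μ)).norm.const_mul _).add (memLp_const _)
  refine h.of_le hf.continuous.aestronglyMeasurable (ae_of_all _ fun x ↦ ?_)
  have h1 := hf.dist_le_mul x 0
  rw [Real.dist_eq, dist_zero_right] at h1
  rw [Real.norm_eq_abs, Real.norm_eq_abs, abs_of_nonneg (a := C * ‖x‖ + |f 0|) (by positivity)]
  have := abs_sub_abs_le_abs_sub (f x) (f 0)
  linarith

/-- The variance is half the mean squared difference of two independent copies. -/
lemma lintegral_lintegral_sq_sub_eq_variance {E : Type*} [MeasurableSpace E] (μ : Measure E)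
    [IsProbabilityMeasure μ] {f : E → ℝ} (hf : MemLp f 2 μ) :
    ∫⁻ x, ∫⁻ y, ENNReal.ofReal ((f x - f y) ^ 2) ∂μ ∂μ = ENNReal.ofReal (2 * Var[f; μ]) := by
  have hf1 := hf.integrable one_le_two
  have hf2 := hf.integrable_sq
  have h1 : ∀ x, ∫⁻ y, ENNReal.ofReal ((f x - f y) ^ 2) ∂μ
      = ENNReal.ofReal ((f x) ^ 2 - 2 * f x * (∫ y, f y ∂μ) + ∫ y, f y ^ 2 ∂μ) := by
    intro x
    have hi : Integrable (fun y ↦ (f x - f y) ^ 2) μ := ((memLp_const _).sub hf).integrable_sq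
    rw [← ofReal_integral_eq_lintegral_ofReal hi (ae_of_all _ fun y ↦ sq_nonneg _)]
    congr 1
    have : ∀ y, (f x - f y) ^ 2 = f x ^ 2 - 2 * f x * f y + f y ^ 2 := fun y ↦ by ring
    simp only [this]
    have hj : Integrable (fun y ↦ f x ^ 2 - 2 * f x * f y) μ :=
      (integrable_const _).sub (hf1.const_mul _)
    rw [integral_add hj hf2,
      integral_sub (integrable_const _) (hf1.const_mul _), integral_const_mul]
    simp
  have h2 : ∀ x, 0 ≤ (f x) ^ 2 - 2 * f x * (∫ y, f y ∂μ) + ∫ y, f y ^ 2 ∂μ := by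
    intro x
    have h3 := variance_nonneg f μ
    rw [variance_eq_sub hf] at h3
    simp only [Pi.pow_apply] at h3
    nlinarith [sq_nonneg (f x - ∫ y, f y ∂μ)]
  simp only [h1]
  have hi : Integrable (fun x ↦ f x ^ 2 - 2 * f x * (∫ y, f y ∂μ) + ∫ y, f y ^ 2 ∂μ) μ :=
    (hf2.sub ((hf1.const_mul 2).mul_const _)).add (integrable_const _)
  rw [← ofReal_integral_eq_lintegral_ofReal hi (ae_of_all _ h2)]
  congr 1
  have hj : Integrable (fun x ↦ f x ^ 2 - 2 * f x * (∫ y, f y ∂μ)) μ :=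
    hf2.sub ((hf1.const_mul 2).mul_const _)
  rw [integral_add hj (integrable_const _),
    integral_sub hf2 ((hf1.const_mul 2).mul_const _), integral_mul_const, integral_const_mul,
    variance_eq_sub hf]
  simp only [integral_const, probReal_univ, Pi.pow_apply, smul_eq_mul]
  ring

/-- The one-dimensional Gaussian Poincaré inequality. -/
lemma LipschitzWith.variance_gaussianReal_le {C : NNReal} {f : ℝ → ℝ} (hf : LipschitzWith C f) :
    Var[f; gaussianReal 0 1] ≤ ∫ x, deriv f x ^ 2 ∂(gaussianReal 0 1) := by
  set γ := gaussianReal 0 1 with hγ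
  have hm : Measurable (fun s ↦ ENNReal.ofReal (deriv f s ^ 2)) :=
    ((measurable_deriv f).pow_const 2).ennreal_ofReal
  let k : ℝ → ℝ → ℝ → ENNReal := fun s x y ↦
    (Set.Ioc y x).indicator (fun _ ↦ ENNReal.ofReal (x - y)) s
  have hk : Measurable (fun p : (ℝ × ℝ) × ℝ ↦ k p.1.1 p.1.2 p.2) := by
    have : MeasurableSet {p : (ℝ × ℝ) × ℝ | p.2 < p.1.1 ∧ p.1.1 ≤ p.1.2} :=
      MeasurableSet.inter (s₁ := {p : (ℝ × ℝ) × ℝ | p.2 < p.1.1})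
        (s₂ := {p : (ℝ × ℝ) × ℝ | p.1.1 ≤ p.1.2})
        (measurableSet_lt (by fun_prop) (by fun_prop))
        (measurableSet_le (by fun_prop) (by fun_prop))
    exact Measurable.indicator (f := fun p : (ℝ × ℝ) × ℝ ↦ ENNReal.ofReal (p.1.2 - p.2))
      (by fun_prop) this
  have hkc (s : ℝ) : Measurable (fun p : ℝ × ℝ ↦ k s p.1 p.2) :=
    hk.comp (by fun_prop : Measurable fun p : ℝ × ℝ ↦ ((s, p.1), p.2))
  have hle : ∀ x y, y ≤ x → ENNReal.ofReal ((f x - f y) ^ 2) ≤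
      ∫⁻ s, k s x y * ENNReal.ofReal (deriv f s ^ 2) := by
    intro x y hxy
    have hi : IntegrableOn (fun s ↦ deriv f s ^ 2) (Set.Ioc y x) :=
      Measure.integrableOn_of_bounded (by simp)
        ((measurable_deriv f).pow_const 2).aestronglyMeasurable (M := C ^ 2)
        (ae_of_all _ fun s ↦ by
          rw [norm_pow]; gcongr; exact hf.abs_deriv_le s)
    calc ENNReal.ofReal ((f x - f y) ^ 2)
        ≤ ENNReal.ofReal ((x - y) * ∫ s in y..x, deriv f s ^ 2) :=
          ENNReal.ofReal_le_ofReal (hf.sq_sub_le_mul_integral hxy)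
      _ = ENNReal.ofReal (x - y) * ∫⁻ s in Set.Ioc y x, ENNReal.ofReal (deriv f s ^ 2) := by
          rw [ENNReal.ofReal_mul (sub_nonneg.2 hxy), intervalIntegral.integral_of_le hxy,
            ofReal_integral_eq_lintegral_ofReal hi (ae_of_all _ fun s ↦ sq_nonneg _)]
      _ = ∫⁻ s, k s x y * ENNReal.ofReal (deriv f s ^ 2) := by
          rw [← lintegral_const_mul _ hm, ← lintegral_indicator measurableSet_Ioc]
          congr with s
          by_cases h : s ∈ Set.Ioc y x <;> simp [k, h]
  -- Symmetrising the kernel removes the condition `y ≤ x`; one of the two summands always vanishes.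
  have hle2 : ∀ x y, ENNReal.ofReal ((f x - f y) ^ 2) ≤
      ∫⁻ s, (k s x y + k s y x) * ENNReal.ofReal (deriv f s ^ 2) := by
    intro x y
    rcases le_total y x with h | h
    · exact (hle x y h).trans (lintegral_mono fun s ↦ by gcongr; exact le_self_add)
    · rw [← neg_sub, neg_sq]
      exact (hle y x h).trans (lintegral_mono fun s ↦ by gcongr; exact le_add_self)
  -- Averaging the kernel turns `ds` into `2 γ(ds)`; the factor `2` cancels the one in the
  -- two-copies formula for the variance.
  have hK : ∀ s, ∫⁻ x, ∫⁻ y, (k s x y + k s y x) ∂γ ∂γ = 2 * gaussianPDF 0 1 s := by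
    intro s
    have h1 := lintegral_lintegral_sub_gaussianReal s
    have h2 : ∫⁻ x, ∫⁻ y, k s y x ∂γ ∂γ = gaussianPDF 0 1 s := by
      rw [lintegral_lintegral_swap (f := fun x y ↦ k s y x)
        ((hkc s).comp measurable_swap).aemeasurable]
      exact h1
    have h3 : ∀ x, ∫⁻ y, (k s x y + k s y x) ∂γ = ∫⁻ y, k s x y ∂γ + ∫⁻ y, k s y x ∂γ :=
      fun x ↦ lintegral_add_left ((hkc s).comp (by fun_prop : Measurable fun y : ℝ ↦ (x, y))) _
    simp only [h3]
    rw [lintegral_add_left (hkc s).lintegral_prod_right', h2, h1, two_mul]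
  have hJ : Measurable (fun p : (ℝ × ℝ) × ℝ ↦ (k p.2 p.1.1 p.1.2 + k p.2 p.1.2 p.1.1) *
      ENNReal.ofReal (deriv f p.2 ^ 2)) := by
    refine Measurable.mul (Measurable.add ?_ ?_) (hm.comp measurable_snd)
    · exact hk.comp (by fun_prop : Measurable fun p : (ℝ × ℝ) × ℝ ↦ ((p.2, p.1.1), p.1.2))
    · exact hk.comp (by fun_prop : Measurable fun p : (ℝ × ℝ) × ℝ ↦ ((p.2, p.1.2), p.1.1))
  have hJ2 : ∀ s, Measurable (fun p : ℝ × ℝ ↦ k s p.1 p.2 + k s p.2 p.1) := fun s ↦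
    (hkc s).add ((hkc s).comp measurable_swap)
  have hfin : ENNReal.ofReal (2 * Var[f; γ]) ≤
      ENNReal.ofReal (2 * ∫ x, deriv f x ^ 2 ∂γ) := by
    have hi : Integrable (fun s ↦ deriv f s ^ 2) γ :=
      Integrable.of_bound ((measurable_deriv f).pow_const 2).aestronglyMeasurable (C ^ 2)
        (ae_of_all _ fun s ↦ by
          rw [norm_pow]; gcongr; exact hf.abs_deriv_le s)
    rw [← lintegral_lintegral_sq_sub_eq_variance γ (hf.memLp_of_isGaussian γ)]
    calc _ ≤ ∫⁻ x, ∫⁻ y, (∫⁻ s, (k s x y + k s y x) *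
          ENNReal.ofReal (deriv f s ^ 2)) ∂γ ∂γ :=
          lintegral_mono fun x ↦ lintegral_mono fun y ↦ hle2 x y
      _ = ∫⁻ p, (∫⁻ s, (k s p.1 p.2 + k s p.2 p.1) *
          ENNReal.ofReal (deriv f s ^ 2)) ∂(γ.prod γ) :=
          (lintegral_prod _ hJ.lintegral_prod_right'.aemeasurable).symm
      _ = ∫⁻ s, ∫⁻ p, (k s p.1 p.2 + k s p.2 p.1) * ENNReal.ofReal (deriv f s ^ 2) ∂(γ.prod γ) :=
          lintegral_lintegral_swap hJ.aemeasurable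
      _ = ∫⁻ s, gaussianPDF 0 1 s * (2 * ENNReal.ofReal (deriv f s ^ 2)) := by
          congr with s
          rw [lintegral_mul_const _ (hJ2 s), lintegral_prod _ (hJ2 s).aemeasurable, hK]
          ring
      _ = ∫⁻ s, 2 * ENNReal.ofReal (deriv f s ^ 2) ∂γ := by
          rw [hγ, gaussianReal_of_var_ne_zero _ one_ne_zero,
            lintegral_withDensity_eq_lintegral_mul _ (measurable_gaussianPDF 0 1)
              (hm.const_mul 2)]
          rfl
      _ = ENNReal.ofReal (2 * ∫ x, deriv f x ^ 2 ∂γ) := by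
          rw [lintegral_const_mul _ hm, ENNReal.ofReal_mul (by norm_num),
            ofReal_integral_eq_lintegral_ofReal hi (ae_of_all _ fun s ↦ sq_nonneg _)]
          simp
  rw [ENNReal.ofReal_le_ofReal_iff (by positivity)] at hfin
  linarith

/-! ### Tensorisation: the Poincaré inequality in dimension `d` -/

/-- The Efron–Stein inequality for a function of two independent variables. -/
lemma variance_prod_le {E F : Type*} [MeasurableSpace E] [MeasurableSpace F] (μ : Measure E)
    (ν : Measure F) [IsProbabilityMeasure μ] [IsProbabilityMeasure ν] {f : E × F → ℝ}
    (hf : MemLp f 2 (μ.prod ν)) (h₁ : ∀ x, MemLp (fun y ↦ f (x, y)) 2 ν)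
    (h₂ : ∀ y, MemLp (fun x ↦ f (x, y)) 2 μ) (ha : MemLp (fun x ↦ ∫ y, f (x, y) ∂ν) 2 μ)
    (hb : MemLp (fun y ↦ ∫ x, f (x, y) ∂μ) 2 ν) :
    (Integrable (fun x ↦ Var[fun y ↦ f (x, y); ν]) μ ∧
      Integrable (fun y ↦ Var[fun x ↦ f (x, y); μ]) ν) ∧
    Var[f; μ.prod ν] ≤ ∫ x, Var[fun y ↦ f (x, y); ν] ∂μ + ∫ y, Var[fun x ↦ f (x, y); μ] ∂ν := by
  set a := fun x ↦ ∫ y, f (x, y) ∂ν with ha_def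
  set b := fun y ↦ ∫ x, f (x, y) ∂μ with hb_def
  have hA : MemLp (fun p : E × F ↦ a p.1) 2 (μ.prod ν) := ha.comp_fst ν
  have hB : MemLp (fun p : E × F ↦ b p.2) 2 (μ.prod ν) := hb.comp_snd μ
  have hfsq := hf.integrable_sq
  have hf1 := hf.integrable one_le_two
  have v1 : ∀ x, Var[fun y ↦ f (x, y); ν] = ∫ y, f (x, y) ^ 2 ∂ν - a x ^ 2 := fun x ↦
    variance_eq_sub (h₁ x)
  have v2 : ∀ y, Var[fun x ↦ f (x, y); μ] = ∫ x, f (x, y) ^ 2 ∂μ - b y ^ 2 := fun y ↦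
    variance_eq_sub (h₂ y)
  simp only [v1, v2]
  refine ⟨⟨hfsq.integral_prod_left.sub ha.integrable_sq,
    hfsq.integral_prod_right.sub hb.integrable_sq⟩, ?_⟩
  rw [integral_sub hfsq.integral_prod_left ha.integrable_sq,
    integral_sub hfsq.integral_prod_right hb.integrable_sq, ← integral_prod _ hfsq,
    ← integral_prod_symm _ hfsq]
  have hMa : ∫ x, a x ∂μ = ∫ p, f p ∂(μ.prod ν) := (integral_prod _ hf1).symm
  have hMb : ∫ y, b y ∂ν = ∫ p, f p ∂(μ.prod ν) := (integral_prod_symm _ hf1).symm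
  have vA : Var[fun p : E × F ↦ a p.1; μ.prod ν] = ∫ x, a x ^ 2 ∂μ - (∫ p, f p ∂(μ.prod ν)) ^ 2 := by
    rw [variance_eq_sub hA, integral_fun_fst (f := a), hMa]
    congr 1
    · simpa using integral_fun_fst (μ := μ) (ν := ν) (fun x ↦ a x ^ 2)
    · simp
  have vB : Var[fun p : E × F ↦ b p.2; μ.prod ν] = ∫ y, b y ^ 2 ∂ν - (∫ p, f p ∂(μ.prod ν)) ^ 2 := by
    rw [variance_eq_sub hB, integral_fun_snd (f := b), hMb]
    congr 1
    · simpa using integral_fun_snd (μ := μ) (ν := ν) (fun y ↦ b y ^ 2)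
    · simp
  have cA : cov[f, fun p : E × F ↦ a p.1; μ.prod ν]
      = ∫ x, a x ^ 2 ∂μ - (∫ p, f p ∂(μ.prod ν)) ^ 2 := by
    rw [covariance_eq_sub hf hA, integral_fun_fst (f := a), hMa]
    congr 1
    · rw [integral_prod _ (hf.integrable_mul hA)]
      simp only [Pi.mul_apply, integral_mul_const, sq]
      rfl
    · simp [sq]
  have cB : cov[f, fun p : E × F ↦ b p.2; μ.prod ν]
      = ∫ y, b y ^ 2 ∂ν - (∫ p, f p ∂(μ.prod ν)) ^ 2 := by
    rw [covariance_eq_sub hf hB, integral_fun_snd (f := b), hMb]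
    congr 1
    · rw [integral_prod_symm _ (hf.integrable_mul hB)]
      simp only [Pi.mul_apply, integral_mul_const, sq]
      rfl
    · simp [sq]
  have cAB : cov[fun p : E × F ↦ a p.1, fun p : E × F ↦ b p.2; μ.prod ν] = 0 := by
    rw [covariance_eq_sub hA hB, integral_fun_fst (f := a), integral_fun_snd (f := b)]
    simp [integral_prod_mul]
  -- The partial means `a` and `b` are uncorrelated, and their covariances with `f` equal their
  -- variances, so this nonnegativity reads `Var a + Var b ≤ Var f`, which rearranges to the claim.
  have h0 := variance_nonneg (f - (fun p : E × F ↦ a p.1) - (fun p : E × F ↦ b p.2)) (μ.prod ν)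
  rw [variance_sub (hf.sub hA) hB, covariance_sub_left hf hA hB, variance_sub hf hA,
    cA, cB, cAB, vA, vB] at h0
  have vf := variance_eq_sub hf
  simp only [Pi.pow_apply] at vf
  linarith

instance isGaussian_pi_gaussianReal {ι : Type*} [Fintype ι] :
    IsGaussian (Measure.pi fun _ : ι ↦ gaussianReal 0 1) := by
  classical
  have h := map_pi_eq_stdGaussian (ι := ι)
  have h2 : (Measure.pi fun _ : ι ↦ gaussianReal 0 1)
      = (stdGaussian (EuclideanSpace ℝ ι)).map (EuclideanSpace.equiv ι ℝ) := by
    rw [← h, Measure.map_map (by fun_prop) (by fun_prop)]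
    exact (Measure.map_id).symm
  rw [h2]
  infer_instance

lemma LipschitzWith.abs_lineDeriv_single_le {ι : Type*} [Fintype ι] [DecidableEq ι] {C : NNReal}
    {f : (ι → ℝ) → ℝ} (hf : LipschitzWith C f) (x : ι → ℝ) (k : ι) :
    |lineDeriv ℝ f x (Pi.single k 1)| ≤ C := by
  simpa [Pi.norm_single] using norm_lineDeriv_le_of_lipschitz ℝ hf (x₀ := x) (v := Pi.single k 1)

lemma LipschitzWith.integrable_sq_lineDeriv {ι : Type*} [Fintype ι] [DecidableEq ι] {C : NNReal}
    {f : (ι → ℝ) → ℝ} (hf : LipschitzWith C f) (μ : Measure (ι → ℝ)) [IsFiniteMeasure μ] (k : ι) :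
    Integrable (fun x ↦ lineDeriv ℝ f x (Pi.single k 1) ^ 2) μ :=
  Integrable.of_bound ((measurable_lineDeriv hf.continuous).pow_const 2).aestronglyMeasurable
    (C ^ 2) (ae_of_all _ fun x ↦ by
      rw [norm_pow]; gcongr; exact hf.abs_lineDeriv_single_le x k)

lemma LipschitzWith.integral_snd {E F : Type*} [NormedAddCommGroup E] [NormedAddCommGroup F]
    [MeasurableSpace F] {ν : Measure F} [IsProbabilityMeasure ν] {C : NNReal} {f : E × F → ℝ}
    (hf : LipschitzWith C f) (hi : ∀ x, Integrable (fun y ↦ f (x, y)) ν) :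
    LipschitzWith C (fun x ↦ ∫ y, f (x, y) ∂ν) := by
  refine LipschitzWith.of_dist_le_mul fun x x' ↦ ?_
  rw [Real.dist_eq, ← integral_sub (hi x) (hi x')]
  have := norm_integral_le_of_norm_le_const (μ := ν) (C := C * dist x x')
    (f := fun y ↦ f (x, y) - f (x', y)) (ae_of_all _ fun y ↦ by
      have := hf.dist_le_mul (x, y) (x', y)
      simpa [Prod.dist_eq, Real.dist_eq] using this)
  simpa using this

/-- The Gaussian Poincaré inequality for Lipschitz functions. -/
theorem LipschitzWith.variance_pi_gaussianReal_le {d : ℕ} {C : NNReal} {f : (Fin d → ℝ) → ℝ}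
    (hf : LipschitzWith C f) :
    Var[f; Measure.pi fun _ ↦ gaussianReal 0 1] ≤
      ∑ k, ∫ x, lineDeriv ℝ f x (Pi.single k 1) ^ 2 ∂(Measure.pi fun _ ↦ gaussianReal 0 1) := by
  induction d with
  | zero =>
    have : f = fun _ ↦ f 0 := funext fun x ↦ by rw [Subsingleton.elim x 0]
    rw [this, variance_eq_integral aemeasurable_const]
    simp
  | succ d ih =>
    set γ := gaussianReal 0 1
    set π := Measure.pi fun _ : Fin d ↦ γ
    let F : ℝ × (Fin d → ℝ) → ℝ := fun p ↦ f (Fin.cons p.1 p.2)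
    have hcons : LipschitzWith 1 (fun p : ℝ × (Fin d → ℝ) ↦ (Fin.cons p.1 p.2 : Fin (d + 1) → ℝ)) := by
      refine LipschitzWith.of_dist_le_mul fun p q ↦ ?_
      rw [NNReal.coe_one, one_mul, dist_pi_le_iff dist_nonneg]
      refine Fin.cases ?_ fun j ↦ ?_
      · exact le_max_left _ _
      · exact (dist_le_pi_dist p.2 q.2 j).trans (le_max_right _ _)
    have hF : LipschitzWith C F := by
      have := hf.comp hcons
      rw [mul_one] at this
      exact this
    have hmp := measurePreserving_piFinSuccAbove (fun _ : Fin (d + 1) ↦ γ) 0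
    have hpre : ∀ g : (Fin (d + 1) → ℝ) → ℝ,
        ∫ x, g x ∂(Measure.pi fun _ ↦ γ) = ∫ p : ℝ × (Fin d → ℝ), g (Fin.cons p.1 p.2) ∂(γ.prod π) := by
      intro g
      rw [← hmp.integral_comp' (fun p : ℝ × (Fin d → ℝ) ↦ g (Fin.cons p.1 p.2))]
      congr with x
      congr 1
      exact (Fin.cons_self_tail x).symm
    have hvar : Var[f; Measure.pi fun _ ↦ γ] = Var[F; γ.prod π] := by
      rw [variance_eq_integral hf.continuous.aemeasurable,
        variance_eq_integral hF.continuous.aemeasurable, hpre, hpre]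
    have hs1 : ∀ x, LipschitzWith C (fun y ↦ F (x, y)) := fun x ↦ by
      have := hF.comp (LipschitzWith.prodMk_left x)
      rw [mul_one] at this
      exact this
    have hs2 : ∀ y, LipschitzWith C (fun x ↦ F (x, y)) := fun y ↦ by
      have := hF.comp (LipschitzWith.prodMk_right y)
      rw [mul_one] at this
      exact this
    have hF' : LipschitzWith C (fun p : (Fin d → ℝ) × ℝ ↦ F (p.2, p.1)) := by
      have := hF.comp (LipschitzWith.prod_snd.prodMk LipschitzWith.prod_fst)
      rw [max_self, mul_one] at this
      exact this
    have ha := hF.integral_snd (ν := π) fun x ↦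
      ((hs1 x).memLp_of_isGaussian π).integrable one_le_two
    have hb := hF'.integral_snd (ν := γ) fun y ↦
      ((hs2 y).memLp_of_isGaussian γ).integrable one_le_two
    obtain ⟨⟨hi1, hi2⟩, hle⟩ := variance_prod_le γ π (hF.memLp_of_isGaussian _)
      (fun x ↦ (hs1 x).memLp_of_isGaussian _) (fun y ↦ (hs2 y).memLp_of_isGaussian _)
      (ha.memLp_of_isGaussian _) (hb.memLp_of_isGaussian _)
    have hint : ∀ k, Integrable (fun p : ℝ × (Fin d → ℝ) ↦
        lineDeriv ℝ f (Fin.cons p.1 p.2) (Pi.single k 1) ^ 2) (γ.prod π) := fun k ↦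
      Integrable.of_bound (((measurable_lineDeriv hf.continuous).comp
        hcons.continuous.measurable).pow_const 2).aestronglyMeasurable
        (C ^ 2) (ae_of_all _ fun x ↦ by
        rw [norm_pow]; gcongr; exact hf.abs_lineDeriv_single_le _ k)
    rw [hvar, Fin.sum_univ_succ]
    simp only [hpre]
    rw [add_comm]
    refine hle.trans (add_le_add ?_ ?_)
    · calc ∫ x, Var[fun y ↦ F (x, y); π] ∂γ
          ≤ ∫ x, ∑ k : Fin d, (∫ y, lineDeriv ℝ f (Fin.cons x y) (Pi.single k.succ 1) ^ 2 ∂π) ∂γ := by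
            refine integral_mono hi1
              (integrable_finsetSum _ fun k _ ↦ (hint k.succ).integral_prod_left) fun x ↦ ?_
            refine (ih (hs1 x)).trans_eq ?_
            congr with k
            congr with y
            congr 1
            simp only [lineDeriv, F]
            congr with t
            congr 1
            ext j
            refine Fin.cases ?_ (fun j ↦ ?_) j
            · simp
            · simp [Pi.single_apply]
        _ = _ := by
            rw [integral_finsetSum _ fun k _ ↦ (hint k.succ).integral_prod_left]
            congr with k
            exact (integral_prod _ (hint k.succ)).symm
    · rw [integral_prod_symm _ (hint 0)]
      refine integral_mono hi2 (hint 0).integral_prod_right fun y ↦ ?_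
      refine (hs2 y).variance_gaussianReal_le.trans_eq ?_
      congr with x
      congr 1
      -- A line derivative is a derivative at time `0`, so the slice is translated to the origin.
      rw [← add_zero x, ← deriv_comp_const_add, lineDeriv]
      congr with t
      simp only [F]
      congr 1
      ext j
      refine Fin.cases ?_ (fun j ↦ ?_) j
      · simp
      · simp

/-! ### Gaussian vectors and the variance of their maximum -/

lemma absolutelyContinuous_pi_fin {d : ℕ} (μ ν : Measure ℝ) [SigmaFinite μ] [SigmaFinite ν]
    (h : μ ≪ ν) : Measure.pi (fun _ : Fin d ↦ μ) ≪ Measure.pi (fun _ : Fin d ↦ ν) := by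
  induction d with
  | zero => rw [Measure.pi_of_empty, Measure.pi_of_empty]
  | succ d ih =>
    have h1 := (measurePreserving_piFinSuccAbove (fun _ : Fin (d + 1) ↦ μ) 0).symm
    have h2 := (measurePreserving_piFinSuccAbove (fun _ : Fin (d + 1) ↦ ν) 0).symm
    rw [← h1.map_eq, ← h2.map_eq]
    exact (h.prod ih).map (MeasurableEquiv.measurable _)

/-- Lets Rademacher's theorem, which concerns Lebesgue measure, be used almost everywhere for the
Gaussian measure. -/
lemma pi_gaussianReal_absolutelyContinuous (d : ℕ) :
    Measure.pi (fun _ : Fin d ↦ gaussianReal 0 1) ≪ volume :=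
  absolutelyContinuous_pi_fin _ _ (gaussianReal_absolutelyContinuous 0 one_ne_zero)

lemma hasGaussianLaw_pi_of_isGaussianProcess {Ω T : Type*} [MeasurableSpace Ω] {P : Measure Ω}
    [Fintype T] {X : T → Ω → ℝ} (hX : IsGaussianProcess X P) :
    HasGaussianLaw (fun ω i ↦ X i ω) P :=
  (hX.hasGaussianLaw Finset.univ).map
    (ContinuousLinearMap.pi fun i : T ↦ ContinuousLinearMap.proj
      (R := ℝ) (φ := fun _ : {x // x ∈ (Finset.univ : Finset T)} ↦ ℝ) ⟨i, Finset.mem_univ i⟩)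

open scoped MatrixOrder in
/-- A Gaussian random vector is in law an affine image of a standard Gaussian vector. -/
lemma exists_map_eq_map_pi_gaussianReal {Ω : Type*} [MeasurableSpace Ω] {P : Measure Ω}
    [IsProbabilityMeasure P] {n : ℕ} {X : Fin n → Ω → ℝ} (hX : HasGaussianLaw (fun ω i ↦ X i ω) P) :
    ∃ (m : Fin n → ℝ) (L : Fin n → StrongDual ℝ (EuclideanSpace ℝ (Fin n))),
      P.map (fun ω i ↦ X i ω) = (Measure.pi fun _ : Fin n ↦ gaussianReal 0 1).map
        (fun g i ↦ m i + L i (WithLp.toLp 2 g)) ∧ ∀ i, ‖L i‖ ^ 2 = Var[X i; P] := by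
  have hX2 : ∀ i, MemLp (X i) 2 P := fun i ↦ (hX.eval i).memLp (by simp)
  have hXm : AEMeasurable (fun ω i ↦ X i ω) P := hX.aemeasurable
  have hG : HasGaussianLaw (fun ω ↦ WithLp.toLp 2 (X · ω)) P := hX.toLp_pi 2
  have := hG.isGaussian_map
  set S : Matrix (Fin n) (Fin n) ℝ := Matrix.of fun i j ↦ cov[X i, X j; P] with hS_def
  set m : EuclideanSpace ℝ (Fin n) := ∫ x, x ∂(P.map (fun ω ↦ WithLp.toLp 2 (X · ω)))
  have hbil : ∀ x y : EuclideanSpace ℝ (Fin n),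
      covarianceBilin (P.map (fun ω ↦ WithLp.toLp 2 (X · ω))) x y
        = x.ofLp ⬝ᵥ (S.mulVec y.ofLp) := by
    intro x y
    rw [covarianceBilin_apply_pi hX2]
    simp only [dotProduct, Matrix.mulVec, Finset.mul_sum, S, Matrix.of_apply]
    exact Finset.sum_congr rfl fun i _ ↦ Finset.sum_congr rfl fun j _ ↦ by ring
  have hS : S.PosSemidef := by
    refine Matrix.PosSemidef.of_dotProduct_mulVec_nonneg ?_ fun x ↦ ?_
    · ext i j
      simp [S, covariance_comm]
    · rw [star_trivial]
      have := hbil (WithLp.toLp 2 x) (WithLp.toLp 2 x)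
      rw [← this]
      exact covarianceBilin_self_nonneg _
  have hlaw : P.map (fun ω ↦ WithLp.toLp 2 (X · ω)) = multivariateGaussian m S := by
    refine IsGaussian.ext ?_ ?_
    · rw [integral_id_multivariateGaussian']
      rfl
    · ext x y
      rw [hbil, covarianceBilin_multivariateGaussian hS]
  -- The square root of the covariance matrix exists even when the field is degenerate; its rows are
  -- the functionals `L i`.
  set A := Matrix.toEuclideanCLM (𝕜 := ℝ) (CFC.sqrt S)
  let L : Fin n → StrongDual ℝ (EuclideanSpace ℝ (Fin n)) := fun i ↦ (EuclideanSpace.proj i).comp A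
  have hmap : P.map (fun ω i ↦ X i ω) = (Measure.pi fun _ : Fin n ↦ gaussianReal 0 1).map
        (fun g i ↦ m i + L i (WithLp.toLp 2 g)) := by
    have h1 : P.map (fun ω i ↦ X i ω) = (P.map (fun ω ↦ WithLp.toLp 2 (X · ω))).map
        (WithLp.ofLp) := by
      rw [AEMeasurable.map_map_of_aemeasurable (by fun_prop) hG.aemeasurable]
      rfl
    rw [h1, hlaw, multivariateGaussian, ← map_pi_eq_stdGaussian,
      Measure.map_map (by fun_prop) (by fun_prop), Measure.map_map (by fun_prop) (by fun_prop)]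
    rfl
  refine ⟨m, L, hmap, fun i ↦ ?_⟩
  have h2 : Var[X i; P] = Var[fun v : Fin n → ℝ ↦ v i; P.map (fun ω i ↦ X i ω)] := by
    rw [variance_map (measurable_pi_apply i).aemeasurable hXm]
    rfl
  rw [h2, hmap, variance_map (measurable_pi_apply i).aemeasurable (by fun_prop), ← variance_dual_stdGaussian,
    ← map_pi_eq_stdGaussian, variance_map (by fun_prop) (by fun_prop)]
  exact (variance_const_add (by fun_prop) (m i)).symm

lemma lipschitzWith_finset_sup' {n : ℕ} [NeZero n] :
    LipschitzWith 1 (fun x : Fin n → ℝ ↦ Finset.univ.sup' Finset.univ_nonempty x) := by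
  refine LipschitzWith.of_le_add fun x y ↦ Finset.sup'_le _ _ fun i hi ↦ ?_
  have h1 : y i ≤ Finset.univ.sup' Finset.univ_nonempty y := Finset.le_sup' y hi
  have h2 := dist_le_pi_dist x y i
  rw [Real.dist_eq] at h2
  linarith [le_abs_self (x i - y i)]

/-- The variance of the maximum of a Gaussian vector is at most the maximal variance. -/
lemma variance_sup'_le {Ω : Type*} [MeasurableSpace Ω] {P : Measure Ω}
    [IsProbabilityMeasure P] {n : ℕ} [NeZero n] {X : Fin n → Ω → ℝ}
    (hX : HasGaussianLaw (fun ω i ↦ X i ω) P) {s : ℝ} (hs : 0 ≤ s)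
    (hvar : ∀ i, Var[X i; P] ≤ s ^ 2) :
    Var[fun ω ↦ Finset.univ.sup' Finset.univ_nonempty (fun i ↦ X i ω); P] ≤ s ^ 2 := by
  obtain ⟨m, L, hmap, hL⟩ := exists_map_eq_map_pi_gaussianReal hX
  set π := Measure.pi fun _ : Fin n ↦ gaussianReal 0 1
  let M : (Fin n → ℝ) → ℝ := fun x ↦ Finset.univ.sup' Finset.univ_nonempty x
  have hM : LipschitzWith 1 M := lipschitzWith_finset_sup'
  let A : (Fin n → ℝ) →L[ℝ] (Fin n → ℝ) := ContinuousLinearMap.pi fun i ↦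
    (L i).comp (EuclideanSpace.equiv (Fin n) ℝ).symm.toContinuousLinearMap
  let f : (Fin n → ℝ) → ℝ := fun g ↦ M (fun i ↦ m i + L i (WithLp.toLp 2 g))
  -- This sup-norm constant serves only for integrability and differentiability; the sharp Euclidean
  -- bound is `hline`.
  have hf : LipschitzWith ‖A‖₊ f := by
    have h1 : LipschitzWith ‖A‖₊ (fun g ↦ m + A g) := by
      refine LipschitzWith.of_dist_le_mul fun x y ↦ ?_
      rw [dist_add_left]
      exact A.lipschitz.dist_le_mul x y
    have h2 := hM.comp h1
    rw [one_mul] at h2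
    exact h2
  have h1 : Var[fun ω ↦ Finset.univ.sup' Finset.univ_nonempty (fun i ↦ X i ω); P] = Var[f; π] := by
    have h2 : Var[fun ω ↦ Finset.univ.sup' Finset.univ_nonempty (fun i ↦ X i ω); P]
        = Var[M; P.map (fun ω i ↦ X i ω)] := by
      rw [variance_map hM.continuous.aemeasurable hX.aemeasurable]
      rfl
    rw [h2, hmap, variance_map hM.continuous.aemeasurable (by fun_prop)]
    rfl
  rw [h1]
  refine hf.variance_pi_gaussianReal_le.trans ?_
  have hLs : ∀ i, ‖L i‖ ≤ s := fun i ↦ by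
    have := (hL i).trans_le (hvar i)
    exact (sq_le_sq₀ (norm_nonneg _) hs).1 this
  have hline : ∀ x v, |lineDeriv ℝ f x v| ≤ s * ‖WithLp.toLp 2 v‖ := by
    intro x v
    have hlip : LipschitzWith (s * ‖WithLp.toLp 2 v‖).toNNReal (fun t : ℝ ↦ f (x + t • v)) := by
      refine LipschitzWith.of_le_add_mul _ fun t t' ↦ Finset.sup'_le _ _ fun i hi ↦ ?_
      have h3 : m i + L i (WithLp.toLp 2 (x + t' • v)) ≤ f (x + t' • v) :=
        Finset.le_sup' (fun i ↦ m i + L i (WithLp.toLp 2 (x + t' • v))) hi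
      have h4 : (t - t') * L i (WithLp.toLp 2 v) ≤ s * ‖WithLp.toLp 2 v‖ * |t - t'| := by
        calc (t - t') * L i (WithLp.toLp 2 v) ≤ |t - t'| * ‖L i (WithLp.toLp 2 v)‖ := by
              rw [Real.norm_eq_abs, ← abs_mul]; exact le_abs_self _
          _ ≤ |t - t'| * (s * ‖WithLp.toLp 2 v‖) := by
              gcongr
              exact ((L i).le_opNorm _).trans (by gcongr; exact hLs i)
          _ = _ := by ring
      rw [Real.coe_toNNReal _ (by positivity), Real.dist_eq]
      simp only [WithLp.toLp_add, WithLp.toLp_smul, map_add, map_smul, smul_eq_mul] at h3 ⊢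
      linarith
    have := hlip.abs_deriv_le 0
    rwa [Real.coe_toNNReal _ (by positivity)] at this
  have hgrad : ∀ᵐ x ∂π, ∑ k, lineDeriv ℝ f x (Pi.single k 1) ^ 2 ≤ s ^ 2 := by
    filter_upwards [(pi_gaussianReal_absolutelyContinuous n).ae_le hf.ae_differentiableAt]
      with x hx
    -- Differentiating along the gradient itself gives `‖v‖² ≤ s ‖v‖`, hence `‖v‖ ≤ s`.
    set v : Fin n → ℝ := fun k ↦ lineDeriv ℝ f x (Pi.single k 1)
    have h5 : lineDeriv ℝ f x v = ∑ k, v k ^ 2 := by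
      rw [hx.lineDeriv_eq_fderiv]
      conv_lhs => rw [pi_eq_sum_univ' v]
      rw [map_sum]
      refine Finset.sum_congr rfl fun k _ ↦ ?_
      rw [map_smul, smul_eq_mul, sq]
      congr 1
      rw [← hx.lineDeriv_eq_fderiv]
    have h6 : ‖WithLp.toLp 2 v‖ ^ 2 = ∑ k, v k ^ 2 := by
      simp [EuclideanSpace.real_norm_sq_eq]
    have h7 := (le_abs_self _).trans (hline x v)
    rw [h5, ← h6] at h7
    rw [← h6]
    have h8 : ‖WithLp.toLp 2 v‖ ≤ s := by
      rcases (norm_nonneg (WithLp.toLp 2 v)).eq_or_lt with h | h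
      · rw [← h]; exact hs
      · nlinarith
    gcongr
  rw [← integral_finsetSum _ fun k _ ↦ hf.integrable_sq_lineDeriv π k]
  refine (integral_mono_ae (integrable_finsetSum _ fun k _ ↦ hf.integrable_sq_lineDeriv π k)
    (integrable_const _) hgrad).trans_eq ?_
  simp

/-! ### Concentration bounded below by the variance -/

lemma intervalIntegral_sub_sq_add (a b c R : ℝ) :
    ∫ t in a..b, (R ^ 2 - (t + c) ^ 2) = R ^ 2 * (b - a) - ((b + c) ^ 3 - (a + c) ^ 3) / 3 := by
  rw [intervalIntegral.integral_comp_add_right (fun u ↦ R ^ 2 - u ^ 2) c,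
    intervalIntegral.integral_sub (by simp) (by simp), integral_pow]
  simp
  ring

/-- Bobkov–Chistyakov lower bound: a law whose intervals of length `ε` have mass at most `q`
cannot have a small variance. -/
lemma le_mul_sqrt_variance_add {μ : Measure ℝ} [IsProbabilityMeasure μ] (hμ : MemLp id 2 μ)
    {ε q : ℝ} (hε : 0 < ε) (hq : ∀ t, μ.real (Set.Icc t (t + ε)) ≤ q) :
    ε ≤ √12 * q * √(Var[id; μ] + ε ^ 2 / 12) := by
  set m := ∫ x, x ∂μ with hm
  set V := Var[id; μ] with hV
  have hV0 : 0 ≤ V := variance_nonneg _ _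
  set S := V + ε ^ 2 / 12 with hS
  have hS0 : 0 < S := by positivity
  -- The argument yields `q ≥ (3 / 4) ε (R² - S) / R³`, which is largest at `R² = 3 S`.
  set R := √(3 * S) with hR
  have hR0 : 0 < R := Real.sqrt_pos.2 (by positivity)
  have hR2 : R ^ 2 = 3 * S := Real.sq_sqrt (by positivity)
  -- The weight of `[t, t + ε]` depends on the distance from its midpoint to the mean; `I` is where
  -- it is nonnegative.
  let ψ : ℝ → ℝ := fun t ↦ R ^ 2 - (t + (ε / 2 - m)) ^ 2
  have hψc : Continuous ψ := by fun_prop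
  set I := Set.Icc (m - ε / 2 - R) (m - ε / 2 + R) with hI
  have hψI : ∀ t ∈ I, 0 ≤ ψ t := fun t ht ↦ by
    have : |t + (ε / 2 - m)| ≤ R := abs_le.2 ⟨by linarith [ht.1], by linarith [ht.2]⟩
    have := sq_le_sq' (abs_le.1 this).1 (abs_le.1 this).2
    simp only [ψ]
    linarith
  have hψI' : ∀ t ∉ I, ψ t ≤ 0 := fun t ht ↦ by
    by_contra! h
    simp only [ψ] at h
    have h1 : (t + (ε / 2 - m)) ^ 2 < R ^ 2 := by linarith
    have h2 := abs_lt.1 (abs_lt_of_sq_lt_sq h1 hR0.le)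
    exact ht ⟨by linarith [h2.1], by linarith [h2.2]⟩
  let H : ℝ → ℝ → ℝ := fun t z ↦ (Set.Icc t (t + ε)).indicator (fun _ ↦ ψ t) z
  have hHm : Measurable (fun p : ℝ × ℝ ↦ H p.1 p.2) := by
    have : MeasurableSet {p : ℝ × ℝ | p.1 ≤ p.2 ∧ p.2 ≤ p.1 + ε} :=
      MeasurableSet.inter (s₁ := {p : ℝ × ℝ | p.1 ≤ p.2}) (s₂ := {p : ℝ × ℝ | p.2 ≤ p.1 + ε})
        (measurableSet_le (by fun_prop) (by fun_prop))
        (measurableSet_le (by fun_prop) (by fun_prop))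
    exact Measurable.indicator (f := fun p : ℝ × ℝ ↦ ψ p.1) (by fun_prop) this
  have hHi : Integrable (fun p : ℝ × ℝ ↦ H p.1 p.2) ((volume.restrict I).prod μ) := by
    have : IsFiniteMeasure (volume.restrict I) := ⟨by simp [hI]⟩
    refine Integrable.of_bound hHm.aestronglyMeasurable (R ^ 2) ?_
    rw [Measure.ae_prod_iff_ae_ae (measurableSet_le hHm.norm measurable_const),
      ae_restrict_iff' measurableSet_Icc]
    refine ae_of_all _ fun t ht ↦ ae_of_all _ fun z ↦ ?_
    refine (norm_indicator_le_norm_self _ _).trans ?_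
    rw [Real.norm_eq_abs, abs_of_nonneg (hψI t ht)]
    simp only [ψ]
    nlinarith [sq_nonneg (t + (ε / 2 - m))]
  have hψi : IntegrableOn ψ I := hψc.continuousOn.integrableOn_compact isCompact_Icc
  have hup : ∫ t in I, ∫ z, H t z ∂μ ≤ q * (4 / 3 * R ^ 3) := by
    have h1 : ∫ t in I, ψ t = 4 / 3 * R ^ 3 := by
      rw [hI, integral_Icc_eq_integral_Ioc, ← intervalIntegral.integral_of_le (by linarith),
        intervalIntegral_sub_sq_add]
      ring
    rw [← h1, ← integral_const_mul]
    refine setIntegral_mono_on hHi.integral_prod_left (hψi.const_mul q) measurableSet_Icc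
      fun t ht ↦ ?_
    simp only [H]
    rw [integral_indicator measurableSet_Icc, setIntegral_const, smul_eq_mul]
    exact mul_le_mul_of_nonneg_right (hq t) (hψI t ht)
  rw [integral_integral_swap (f := H) hHi] at hup
  -- Integrating `ψ` over all of `[z - ε, z]` instead only adds nonpositive values. The term `ε² /
  -- 12` is the variance of the uniform law on that interval.
  have hin : ∀ z, ε * (R ^ 2 - (z - m) ^ 2 - ε ^ 2 / 12) ≤ ∫ t in I, H t z := by
    intro z
    have h1 : ∫ t in (z - ε)..z, ψ t = ε * (R ^ 2 - (z - m) ^ 2 - ε ^ 2 / 12) := by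
      rw [intervalIntegral_sub_sq_add]
      ring
    rw [← h1, intervalIntegral.integral_of_le (by linarith), ← integral_Icc_eq_integral_Ioc,
      ← integral_indicator measurableSet_Icc, ← integral_indicator measurableSet_Icc]
    have h2 : ∀ t, I.indicator (fun t ↦ H t z) t
        = (Set.Icc (z - ε) z).indicator (I.indicator ψ) t := by
      intro t
      have : z ∈ Set.Icc t (t + ε) ↔ t ∈ Set.Icc (z - ε) z := by
        simp only [Set.mem_Icc]
        constructor <;> rintro ⟨_, _⟩ <;> constructor <;> linarith
      by_cases ht : t ∈ I <;> by_cases hz : t ∈ Set.Icc (z - ε) z <;> simp [H, ht, hz, this]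
    rw [funext h2]
    refine integral_mono
      ((hψc.continuousOn.integrableOn_compact isCompact_Icc).integrable_indicator measurableSet_Icc)
      ((hψi.integrable_indicator measurableSet_Icc).indicator measurableSet_Icc) fun t ↦ ?_
    by_cases hz : t ∈ Set.Icc (z - ε) z
    · by_cases ht : t ∈ I
      · simp [hz, ht]
      · simpa [hz, ht] using hψI' t ht
    · simp [hz]
  have hsq : Integrable (fun z ↦ (z - m) ^ 2) μ := (hμ.sub (memLp_const m)).integrable_sq
  have hlow : ε * (R ^ 2 - V - ε ^ 2 / 12) ≤ ∫ z, (∫ t in I, H t z) ∂μ := by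
    have hVe : V = ∫ z, (z - m) ^ 2 ∂μ := variance_eq_integral hμ.aemeasurable
    have h3 : ∫ z, ε * (R ^ 2 - (z - m) ^ 2 - ε ^ 2 / 12) ∂μ = ε * (R ^ 2 - V - ε ^ 2 / 12) := by
      have h4 : Integrable (fun z ↦ R ^ 2 - (z - m) ^ 2) μ := (integrable_const _).sub hsq
      rw [integral_const_mul, integral_sub h4 (integrable_const _),
        integral_sub (integrable_const _) hsq, ← hVe]
      simp
    rw [← h3]
    have h5 : Integrable (fun z ↦ ε * (R ^ 2 - (z - m) ^ 2 - ε ^ 2 / 12)) μ :=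
      (((integrable_const _).sub hsq).sub (integrable_const _)).const_mul _
    exact integral_mono h5 hHi.integral_prod_right hin
  have hfin : ε * (2 * S) ≤ q * (4 / 3 * R ^ 3) := by
    refine le_trans (le_of_eq ?_) (hlow.trans hup)
    rw [hR2, hS]
    ring
  have h5 : R = √3 * √S := by rw [hR, Real.sqrt_mul (by norm_num)]
  have h6 : √12 = 2 * √3 := by
    rw [show (12 : ℝ) = 2 ^ 2 * 3 by norm_num, Real.sqrt_mul (by norm_num),
      Real.sqrt_sq (by norm_num)]
  have h7 : ε * (2 * S) ≤ (√12 * q * √S) * (2 * S) := by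
    refine hfin.trans_eq ?_
    rw [pow_succ, hR2, h5, h6]
    ring
  exact le_of_mul_le_mul_right h7 (by positivity)

lemma le_concentrationFunction {Ω : Type*} [MeasurableSpace Ω] (P : Measure Ω)
    [IsProbabilityMeasure P] (Z : Ω → ℝ) (ε t : ℝ) :
    P.real {ω | t ≤ Z ω ∧ Z ω ≤ t + ε} ≤ concentrationFunction P Z ε :=
  le_ciSup (f := fun t ↦ P.real {ω | t ≤ Z ω ∧ Z ω ≤ t + ε})
    ⟨1, by rintro _ ⟨t, rfl⟩; exact measureReal_le_one⟩ t

lemma div_sqrt_le_concentrationFunction {Ω : Type*} [MeasurableSpace Ω] {P : Measure Ω}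
    [IsProbabilityMeasure P] {Z : Ω → ℝ} (hZ : MemLp Z 2 P) {s ε : ℝ} (hε : 0 < ε)
    (hs : Var[Z; P] ≤ s ^ 2) :
    (ε / √12) / √(s ^ 2 + ε ^ 2 / 12) ≤ concentrationFunction P Z ε := by
  have hm := hZ.aemeasurable
  have := Measure.isProbabilityMeasure_map (μ := P) hm
  have hid : MemLp id 2 (P.map Z) := (memLp_map_measure_iff aestronglyMeasurable_id hm).2 hZ
  have h := le_mul_sqrt_variance_add hid hε (q := concentrationFunction P Z ε) fun t ↦ by
    rw [measureReal_def, Measure.map_apply_of_aemeasurable hm measurableSet_Icc]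
    exact le_concentrationFunction P Z ε t
  rw [variance_id_map hm] at h
  have hq : 0 ≤ concentrationFunction P Z ε :=
    measureReal_nonneg.trans (le_concentrationFunction P Z ε 0)
  rw [div_le_iff₀ (by positivity), div_le_iff₀ (by positivity)]
  calc ε ≤ √12 * concentrationFunction P Z ε * √(Var[Z; P] + ε ^ 2 / 12) := h
    _ ≤ √12 * concentrationFunction P Z ε * √(s ^ 2 + ε ^ 2 / 12) := by gcongr
    _ = _ := by ring

/-! ### Gaussian density and tail estimates -/

lemma gaussianPDFReal_zero_one_eq (x : ℝ) :
    gaussianPDFReal 0 1 x = (√(2 * Real.pi))⁻¹ * Real.exp (-x ^ 2 / 2) := by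
  simp [gaussianPDFReal]

lemma gaussianPDFReal_zero_one_le_of_abs_le {x y : ℝ} (h : |x| ≤ |y|) :
    gaussianPDFReal 0 1 y ≤ gaussianPDFReal 0 1 x := by
  rw [gaussianPDFReal_zero_one_eq, gaussianPDFReal_zero_one_eq]
  have := sq_le_sq.2 h
  gcongr

lemma gaussianReal_real_eq_setIntegral {s : Set ℝ} (hs : MeasurableSet s) :
    (gaussianReal 0 1).real s = ∫ x in s, gaussianPDFReal 0 1 x := by
  have := setIntegral_gaussianReal_eq s hs (fun _ ↦ 1)
  simpa using this

lemma gaussianReal_real_le {s : Set ℝ} (hs : MeasurableSet s) {a δ K : ℝ} (hδ : 0 ≤ δ)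
    (hK : 0 ≤ K) (h : ∀ x ∈ s ∩ Set.Icc a (a + δ), gaussianPDFReal 0 1 x ≤ K) :
    (gaussianReal 0 1).real (s ∩ Set.Icc a (a + δ)) ≤ δ * K := by
  have hm := hs.inter (measurableSet_Icc (a := a) (b := a + δ))
  have hvol : volume (s ∩ Set.Icc a (a + δ)) ≠ ⊤ :=
    ((measure_mono Set.inter_subset_right).trans_lt (by simp)).ne
  have hvol2 : volume.real (s ∩ Set.Icc a (a + δ)) ≤ δ := by
    refine (measureReal_mono Set.inter_subset_right (by simp)).trans_eq ?_
    simp [measureReal_def, hδ]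
  rw [gaussianReal_real_eq_setIntegral hm]
  calc ∫ x in s ∩ Set.Icc a (a + δ), gaussianPDFReal 0 1 x
      ≤ ∫ x in s ∩ Set.Icc a (a + δ), K :=
        setIntegral_mono_on (integrable_gaussianPDFReal 0 1).integrableOn
          (integrableOn_const hvol) hm h
    _ = volume.real (s ∩ Set.Icc a (a + δ)) * K := by simp
    _ ≤ δ * K := by gcongr

/-- A Mills-type lower bound for the Gaussian tail. -/
lemma gaussianPDFReal_le_mul_tail (v : ℝ) :
    gaussianPDFReal 0 1 v ≤ Real.exp (3 / 2) * (1 + max v 0) * (gaussianReal 0 1).real (Set.Ici v) := by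
  set a := max v 0 with ha
  have ha0 : 0 ≤ a := le_max_right _ _
  set u := (1 + a)⁻¹ with hu
  have hu0 : 0 < u := by positivity
  have hau : (1 + a) * u = 1 := mul_inv_cancel₀ (by positivity)
  have h1 : gaussianPDFReal 0 1 v ≤ gaussianPDFReal 0 1 a := by
    apply gaussianPDFReal_zero_one_le_of_abs_le
    rw [abs_of_nonneg ha0]
    exact max_le (le_abs_self v) (abs_nonneg v)
  -- With `u = 1 / (1 + a)` the exponent changes by `a u + u² / 2 ≤ 1 + 1 / 2`.
  have h2 : gaussianPDFReal 0 1 a ≤ Real.exp (3 / 2) * gaussianPDFReal 0 1 (a + u) := by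
    rw [gaussianPDFReal_zero_one_eq, gaussianPDFReal_zero_one_eq, mul_left_comm, ← Real.exp_add]
    gcongr
    nlinarith
  have h3 : u * gaussianPDFReal 0 1 (a + u) ≤ (gaussianReal 0 1).real (Set.Ici v) := by
    calc u * gaussianPDFReal 0 1 (a + u)
        = ∫ x in Set.Icc a (a + u), gaussianPDFReal 0 1 (a + u) := by
          simp [measureReal_def, hu0.le]
      _ ≤ ∫ x in Set.Icc a (a + u), gaussianPDFReal 0 1 x := by
          refine setIntegral_mono_on (integrableOn_const (by simp))
            (integrable_gaussianPDFReal 0 1).integrableOn measurableSet_Icc fun x hx ↦ ?_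
          apply gaussianPDFReal_zero_one_le_of_abs_le
          rw [abs_of_nonneg (ha0.trans hx.1), abs_of_nonneg (by positivity)]
          exact hx.2
      _ = (gaussianReal 0 1).real (Set.Icc a (a + u)) :=
          (gaussianReal_real_eq_setIntegral measurableSet_Icc).symm
      _ ≤ _ := measureReal_mono fun x hx ↦ (le_max_left v 0).trans hx.1
  calc gaussianPDFReal 0 1 v ≤ Real.exp (3 / 2) * gaussianPDFReal 0 1 (a + u) := h1.trans h2
    _ = Real.exp (3 / 2) * (1 + a) * (u * gaussianPDFReal 0 1 (a + u)) := by
        rw [show Real.exp (3 / 2) * (1 + a) * (u * gaussianPDFReal 0 1 (a + u))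
          = Real.exp (3 / 2) * ((1 + a) * u) * gaussianPDFReal 0 1 (a + u) by ring, hau, mul_one]
    _ ≤ _ := by gcongr

/-- An upper set contains the tail beyond each of its points, so the Mills bound dominates the
density at such a point by the mass of the whole set. -/
lemma gaussianReal_real_upperSet_inter_Icc_le {s : Set ℝ} (hs : MeasurableSet s)
    (hup : IsUpperSet s) {a δ : ℝ} (hδ : 0 ≤ δ) :
    (gaussianReal 0 1).real (s ∩ Set.Icc a (a + δ)) ≤
      δ * (Real.exp (3 / 2) * (1 + max (a + δ) 0)) * (gaussianReal 0 1).real s := by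
  rw [mul_assoc]
  refine gaussianReal_real_le hs hδ (by positivity) fun x hx ↦ ?_
  refine (gaussianPDFReal_le_mul_tail x).trans ?_
  gcongr
  · exact hx.2.2
  · exact measure_ne_top _ _
  · exact fun y hy ↦ hup hy hx.1

lemma IndepFun.measureReal_upperSet_inter_Icc_le {Ω β : Type*} [MeasurableSpace Ω]
    [MeasurableSpace β] {P : Measure Ω} [IsProbabilityMeasure P] {W : Ω → β} {V : Ω → ℝ}
    (hW : Measurable W) (hV : Measurable V) (hWV : IndepFun W V P)
    (hVlaw : P.map V = gaussianReal 0 1) {T : Set (β × ℝ)} (hT : MeasurableSet T)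
    (hup : ∀ w, IsUpperSet (Prod.mk w ⁻¹' T)) {a δ : ℝ} (hδ : 0 ≤ δ) :
    P.real {ω | (W ω, V ω) ∈ T ∧ V ω ∈ Set.Icc a (a + δ)} ≤
      δ * (Real.exp (3 / 2) * (1 + max (a + δ) 0)) * P.real {ω | (W ω, V ω) ∈ T} := by
  set c := δ * (Real.exp (3 / 2) * (1 + max (a + δ) 0)) with hc
  have hc0 : 0 ≤ c := by positivity
  have hlaw := hWV.map_prod_eq_prod_map_map hW.aemeasurable hV.aemeasurable
  rw [hVlaw] at hlaw
  have hpair : Measurable fun ω ↦ (W ω, V ω) := hW.prodMk hV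
  have hprob := Measure.isProbabilityMeasure_map (μ := P) hW.aemeasurable
  have hT2 : MeasurableSet (T ∩ Prod.snd ⁻¹' Set.Icc a (a + δ)) :=
    hT.inter (measurable_snd measurableSet_Icc)
  have h1 : P {ω | (W ω, V ω) ∈ T ∧ V ω ∈ Set.Icc a (a + δ)}
      = ∫⁻ w, gaussianReal 0 1 (Prod.mk w ⁻¹' T ∩ Set.Icc a (a + δ)) ∂(P.map W) := by
    have := Measure.map_apply (μ := P) hpair hT2
    rw [hlaw, Measure.prod_apply hT2] at this
    exact this.symm
  have h2 : P {ω | (W ω, V ω) ∈ T} = ∫⁻ w, gaussianReal 0 1 (Prod.mk w ⁻¹' T) ∂(P.map W) := by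
    have := Measure.map_apply (μ := P) hpair hT
    rw [hlaw, Measure.prod_apply hT] at this
    exact this.symm
  have h3 : P {ω | (W ω, V ω) ∈ T ∧ V ω ∈ Set.Icc a (a + δ)}
      ≤ ENNReal.ofReal c * P {ω | (W ω, V ω) ∈ T} := by
    rw [h1, h2, ← lintegral_const_mul _ (measurable_measure_prodMk_left hT)]
    refine lintegral_mono fun w ↦ ?_
    have h4 := gaussianReal_real_upperSet_inter_Icc_le (a := a)
      (measurable_prodMk_left hT) (hup w) hδ
    rw [← ofReal_measureReal, ← ofReal_measureReal (s := Prod.mk w ⁻¹' T),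
      ← ENNReal.ofReal_mul hc0]
    exact ENNReal.ofReal_le_ofReal h4
  have h5 := ENNReal.toReal_mono (ENNReal.mul_ne_top ENNReal.ofReal_ne_top (measure_ne_top _ _)) h3
  rwa [ENNReal.toReal_mul, ENNReal.toReal_ofReal hc0] at h5

lemma map_sub_integral_eq_gaussianReal {Ω : Type*} [MeasurableSpace Ω] {P : Measure Ω} {V : Ω → ℝ} (hV : HasGaussianLaw V P)
    (hvar : Var[V; P] = 1) : P.map (fun ω ↦ V ω - ∫ ω, V ω ∂P) = gaussianReal 0 1 := by
  have h1 : P.map (fun ω ↦ V ω - ∫ ω, V ω ∂P) = (P.map V).map (fun x ↦ x - ∫ ω, V ω ∂P) := by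
    rw [AEMeasurable.map_map_of_aemeasurable (by fun_prop) hV.aemeasurable]
    rfl
  rw [h1, hV.map_eq_gaussianReal, hvar, gaussianReal_map_sub_const, sub_self, Real.toNNReal_one]

/-- With nonpositive mean, the density of `V` on `[0, δ]` is largest at `0`; moreover `1 / √(2π) ≤ 1
/ 2`. -/
lemma measureReal_Icc_le_exp {Ω : Type*} [MeasurableSpace Ω] {P : Measure Ω} {V : Ω → ℝ} (hVm : Measurable V) (hV : HasGaussianLaw V P)
    (hvar : Var[V; P] = 1) {δ : ℝ} (hδ : 0 ≤ δ) (hmean : ∫ ω, V ω ∂P ≤ 0) :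
    P.real {ω | 0 ≤ V ω ∧ V ω ≤ δ} ≤ δ * (1 / 2 * Real.exp (-(∫ ω, V ω ∂P) ^ 2 / 2)) := by
  set m := ∫ ω, V ω ∂P with hm
  have hlaw := map_sub_integral_eq_gaussianReal hV hvar
  rw [← hm] at hlaw
  have h1 : P.real {ω | 0 ≤ V ω ∧ V ω ≤ δ} = (gaussianReal 0 1).real (Set.univ ∩ Set.Icc (-m) (-m + δ)) := by
    rw [← hlaw, map_measureReal_apply (hVm.sub_const m) (MeasurableSet.univ.inter measurableSet_Icc)]
    congr 1
    ext ω
    simp only [Set.univ_inter, Set.mem_preimage, Set.mem_Icc, Set.mem_ofPred_eq]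
    constructor <;> rintro ⟨_, _⟩ <;> constructor <;> linarith
  rw [h1]
  refine gaussianReal_real_le MeasurableSet.univ hδ (by positivity) fun x hx ↦ ?_
  have h2 : gaussianPDFReal 0 1 x ≤ gaussianPDFReal 0 1 m := by
    apply gaussianPDFReal_zero_one_le_of_abs_le
    rw [abs_of_nonpos hmean]
    exact hx.2.1.trans (le_abs_self x)
  refine h2.trans ?_
  rw [gaussianPDFReal_zero_one_eq]
  gcongr
  rw [one_div]
  refine inv_anti₀ (by norm_num) (Real.le_sqrt_of_sq_le ?_)
  nlinarith [Real.pi_gt_three]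

/-! ### Decomposition by the location of the maximum -/

/-- The event that `i` is the least index at which the maximum of `Y` is attained. -/
def argmaxEvent {Ω ι : Type*} [LinearOrder ι] (Y : ι → Ω → ℝ) (i : ι) : Set Ω :=
  {ω | ∀ j, Y j ω ≤ Y i ω ∧ (j < i → Y j ω < Y i ω)}

section Argmax

variable {Ω ι : Type*} [LinearOrder ι] {Y : ι → Ω → ℝ}

lemma pairwise_disjoint_argmaxEvent : Pairwise (Function.onFun Disjoint (argmaxEvent Y)) := by
  intro i j hij
  refine Set.disjoint_left.2 fun ω hi hj ↦ ?_
  rcases lt_or_gt_of_ne hij with h | h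
  · exact absurd ((hj i).2 h) (not_lt.2 (hi j).1)
  · exact absurd ((hi j).2 h) (not_lt.2 (hj i).1)

variable [Fintype ι]

lemma exists_mem_argmaxEvent [Nonempty ι] (Y : ι → Ω → ℝ) (ω : Ω) : ∃ i, ω ∈ argmaxEvent Y i := by
  classical
  obtain ⟨i₀, -, hi₀⟩ := Finset.exists_max_image Finset.univ (fun i ↦ Y i ω) Finset.univ_nonempty
  let s := Finset.univ.filter fun i ↦ ∀ j, Y j ω ≤ Y i ω
  have hs : s.Nonempty := ⟨i₀, by simpa [s] using hi₀⟩
  have hmin := s.min'_mem hs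
  refine ⟨s.min' hs, fun j ↦ ⟨(Finset.mem_filter.1 hmin).2 j, fun hj ↦ ?_⟩⟩
  by_contra! h
  have : j ∈ s := by
    simp only [s, Finset.mem_filter, Finset.mem_univ, true_and]
    exact fun l ↦ ((Finset.mem_filter.1 hmin).2 l).trans h
  exact absurd (s.min'_le j this) (not_le.2 hj)

variable [MeasurableSpace Ω]

lemma measurableSet_argmaxEvent (hY : ∀ i, Measurable (Y i)) (i : ι) :
    MeasurableSet (argmaxEvent Y i) := by
  have : argmaxEvent Y i
      = ⋂ j, ({ω | Y j ω ≤ Y i ω} ∩ if j < i then {ω | Y j ω < Y i ω} else Set.univ) := by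
    ext ω
    simp only [argmaxEvent, Set.mem_ofPred_eq, Set.mem_iInter, Set.mem_inter_iff]
    refine forall_congr' fun j ↦ and_congr_right fun _ ↦ ?_
    split_ifs with h <;> simp [h]
  rw [this]
  refine MeasurableSet.iInter fun j ↦ (measurableSet_le (hY j) (hY i)).inter ?_
  split_ifs
  · exact measurableSet_lt (hY j) (hY i)
  · exact MeasurableSet.univ

lemma sum_measureReal_argmaxEvent_le_one (P : Measure Ω) [IsProbabilityMeasure P]
    (hY : ∀ i, Measurable (Y i)) : ∑ i, P.real (argmaxEvent Y i) ≤ 1 := by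
  rw [← measureReal_biUnion_finset (fun i _ j _ hij ↦ pairwise_disjoint_argmaxEvent hij)
    fun i _ ↦ measurableSet_argmaxEvent hY i]
  exact measureReal_le_one

variable {P : Measure Ω} [IsProbabilityMeasure P]

/-- Unit variances make every regression coefficient on `Y i` at most `1`. With the residuals
frozen, raising `Y i` raises it at least as fast as every competitor, so the argmax event is an
upper set in `Y i`. -/
lemma measureReal_argmaxEvent_inter_le (hY : ∀ i, Measurable (Y i))
    (hG : HasGaussianLaw (fun ω i ↦ Y i ω) P) (hvar : ∀ i, Var[Y i; P] = 1) (i : ι) {δ : ℝ}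
    (hδ : 0 ≤ δ) :
    P.real (argmaxEvent Y i ∩ {ω | 0 ≤ Y i ω ∧ Y i ω ≤ δ}) ≤
      δ * (Real.exp (3 / 2) * (1 + max (-(∫ ω, Y i ω ∂P) + δ) 0)) * P.real (argmaxEvent Y i) := by
  set m := ∫ ω, Y i ω ∂P with hm
  have hY2 : ∀ j, MemLp (Y j) 2 P := fun j ↦ (hG.eval j).memLp (by simp)
  let ρ : ι → ℝ := fun j ↦ cov[Y j, Y i; P]
  have hρi : ρ i = 1 := by
    simp only [ρ]
    rw [covariance_self (hY i).aemeasurable, hvar]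
  have hρ : ∀ j, ρ j ≤ 1 := fun j ↦ by
    have h1 := variance_nonneg (Y j - Y i) P
    rw [variance_sub (hY2 j) (hY2 i), hvar, hvar] at h1
    simp only [ρ]
    linarith
  let W : ι → Ω → ℝ := fun j ω ↦ Y j ω - ρ j * Y i ω
  have hWm : Measurable fun ω j ↦ W j ω := by fun_prop
  -- Jointly Gaussian and uncorrelated families are independent; `Unit` presents `Y i` as a family.
  have hWY : IndepFun (fun ω j ↦ W j ω) (fun ω ↦ Y i ω) P := by
    let p : ι → (ι → ℝ) →L[ℝ] ℝ := ContinuousLinearMap.proj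
    let A : (ι → ℝ) →L[ℝ] (ι → ℝ) × (Unit → ℝ) :=
      (ContinuousLinearMap.pi fun j ↦ p j - ρ j • p i).prod (ContinuousLinearMap.pi fun _ ↦ p i)
    have hlaw : HasGaussianLaw (fun ω ↦ (fun j ↦ W j ω, fun _ : Unit ↦ Y i ω)) P := hG.map A
    have h1 := hlaw.indepFun_of_covariance_eval (X := W) (Y := fun _ : Unit ↦ Y i) fun j _ ↦ by
      have h2 : cov[Y j - fun ω ↦ ρ j * Y i ω, Y i; P] = 0 := by
        rw [covariance_sub_left (hY2 j) ((hY2 i).const_mul _) (hY2 i), covariance_const_mul_left,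
          covariance_self (hY i).aemeasurable, hvar]
        simp [ρ]
      exact h2
    exact h1.comp measurable_id (measurable_pi_apply ())
  have hWV : IndepFun (fun ω j ↦ W j ω) (fun ω ↦ Y i ω - m) P :=
    hWY.comp measurable_id (measurable_id.sub_const m)
  let T : Set ((ι → ℝ) × ℝ) := argmaxEvent (fun j p ↦ p.1 j + ρ j * (p.2 + m)) i
  have hT : MeasurableSet T := measurableSet_argmaxEvent (fun j ↦ by fun_prop) i
  have hTiff : ∀ ω, ((fun j ↦ W j ω, Y i ω - m) ∈ T ↔ ω ∈ argmaxEvent Y i) := fun ω ↦ by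
    simp [T, argmaxEvent, W]
  have hup : ∀ w, IsUpperSet (Prod.mk w ⁻¹' T) := by
    intro w v v' hv h j
    have h1 := h j
    have h2 := mul_le_mul_of_nonneg_right (hρ j) (sub_nonneg.2 hv)
    simp only [hρi, one_mul] at h1 ⊢
    exact ⟨by linarith [h1.1], fun hj ↦ by linarith [h1.2 hj]⟩
  have hfin := IndepFun.measureReal_upperSet_inter_Icc_le hWm ((hY i).sub_const m) hWV
    (map_sub_integral_eq_gaussianReal (hG.eval i) (hvar i)) hT hup (a := -m) hδ
  simp only [hTiff, Set.ofPred_mem_eq] at hfin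
  refine le_trans (le_of_eq ?_) hfin
  congr 1
  ext ω
  refine and_congr_right fun _ ↦ ?_
  simp only [Set.mem_ofPred_eq, Set.mem_Icc]
  constructor <;> rintro ⟨_, _⟩ <;> constructor <;> linarith

end Argmax

/-! ### Numerical constants and ordered values -/

lemma sum_fin_inv_sq_le_two (n : ℕ) : ∑ k : Fin n, (((k : ℕ) + 1 : ℝ) ^ 2)⁻¹ ≤ 2 := by
  rw [Fin.sum_univ_eq_sum_range (fun k ↦ (((k : ℕ) + 1 : ℝ) ^ 2)⁻¹)]
  have h : ∀ m : ℕ, ∑ k ∈ Finset.range (m + 1), (((k : ℕ) + 1 : ℝ) ^ 2)⁻¹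
      ≤ 2 - ((m : ℝ) + 1)⁻¹ := by
    intro m
    induction m with
    | zero => norm_num
    | succ m ih =>
      rw [Finset.sum_range_succ]
      push_cast
      have h : (((m : ℝ) + 1 + 1) ^ 2)⁻¹ ≤ ((m : ℝ) + 1)⁻¹ - ((m : ℝ) + 1 + 1)⁻¹ := by
        rw [inv_sub_inv (by positivity) (by positivity), inv_eq_one_div]
        apply div_le_div₀ <;> nlinarith [(Nat.cast_nonneg m : (0 : ℝ) ≤ m)]
      linarith
  rcases n with _ | n
  · simp
  · exact (h n).trans (sub_le_self _ (by positivity))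

lemma exp_three_halves_le : Real.exp (3 / 2) ≤ 9 / 2 := by
  have h : Real.exp (3 / 2) ^ 2 = Real.exp 1 ^ 3 := by
    rw [← Real.exp_nat_mul, ← Real.exp_nat_mul]
    norm_num
  have h1 := Real.exp_one_lt_d9
  have h2 : Real.exp 1 ^ 3 ≤ 2.7182818286 ^ 3 := by gcongr
  refine le_of_sq_le_sq ?_ (by norm_num)
  rw [h]
  exact h2.trans (by norm_num)

section OrderedValue

variable {n : ℕ} [NeZero n] {σ : Fin n → ℝ}

lemma orderedValue_zero_le (σ : Fin n → ℝ) (i : Fin n) : orderedValue σ 0 ≤ σ i := by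
  have h := Tuple.monotone_sort σ (Fin.zero_le ((Tuple.sort σ).symm i))
  simpa [orderedValue] using h

lemma le_orderedValue_top (σ : Fin n → ℝ) (i : Fin n) : σ i ≤ orderedValue σ ⊤ := by
  have h := Tuple.monotone_sort σ (le_top (a := (Tuple.sort σ).symm i))
  simpa [orderedValue] using h

/-- The maximum `max_k (1 + √(2 log k)) / σ_(k)` in the denominator of `sigmaBar`. -/
noncomputable def weightMax (σ : Fin n → ℝ) : ℝ :=
  Finset.univ.sup' Finset.univ_nonempty
    (fun k : Fin n ↦ (1 + √(2 * Real.log ((k : ℕ) + 1 : ℝ))) / orderedValue σ k)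

lemma le_weightMax (σ : Fin n → ℝ) (k : Fin n) :
    (1 + √(2 * Real.log ((k : ℕ) + 1 : ℝ))) / orderedValue σ k ≤ weightMax σ :=
  Finset.le_sup' (fun k : Fin n ↦ (1 + √(2 * Real.log ((k : ℕ) + 1 : ℝ))) / orderedValue σ k)
    (Finset.mem_univ k)

lemma one_div_orderedValue_zero_le_weightMax (σ : Fin n → ℝ) :
    1 / orderedValue σ 0 ≤ weightMax σ := by
  simpa using le_weightMax σ 0

end OrderedValue

/-! ### The upper bound for short intervals -/

lemma measureReal_sup'_mem_Icc_le {n : ℕ} [NeZero n] {μ : Measure (Fin n → ℝ)} [IsGaussian μ]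
    {σ : Fin n → ℝ} (hσ : 0 < orderedValue σ 0) (hvar : ∀ i, Var[fun x ↦ x i; μ] = σ i ^ 2)
    {ε : ℝ} (hε : 0 < ε) (hε2 : ε / orderedValue σ 0 ≤ 1 / 11) (t : ℝ) :
    μ.real {x | t ≤ Finset.univ.sup' Finset.univ_nonempty x ∧
      Finset.univ.sup' Finset.univ_nonempty x ≤ t + ε} ≤
      11 * (ε * (1 / orderedValue σ 0 + weightMax σ)) := by
  have hσp : ∀ i, 0 < σ i := fun i ↦ hσ.trans_le (orderedValue_zero_le σ i)
  let Y : Fin n → (Fin n → ℝ) → ℝ := fun i x ↦ (σ i)⁻¹ * (x i - t)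
  have hY : ∀ i, Measurable (Y i) := fun i ↦ by fun_prop
  have hYvar : ∀ i, Var[Y i; μ] = 1 := fun i ↦ by
    rw [variance_const_mul, variance_sub_const (measurable_pi_apply i).aestronglyMeasurable, hvar, ← mul_pow,
      inv_mul_cancel₀ (hσp i).ne', one_pow]
  have hG : HasGaussianLaw (fun x i ↦ Y i x) μ := by
    let A : (Fin n → ℝ) →L[ℝ] (Fin n → ℝ) :=
      ContinuousLinearMap.pi fun i ↦ (σ i)⁻¹ • ContinuousLinearMap.proj i
    have h1 : (fun x i ↦ Y i x) = (fun x ↦ x - fun i ↦ (σ i)⁻¹ * t) ∘ A := by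
      ext x i
      simp [Y, A, mul_sub]
    constructor
    rw [h1, ← Measure.map_map (by fun_prop) (by fun_prop)]
    infer_instance
  set s₀ := orderedValue σ 0
  set M := weightMax σ
  have hM0 : 0 ≤ M := le_trans (by positivity) (one_div_orderedValue_zero_le_weightMax σ)
  let E : Fin n → Set (Fin n → ℝ) := fun i ↦
    argmaxEvent Y i ∩ {x | 0 ≤ Y i x ∧ Y i x ≤ ε / σ i}
  -- The argmax of `Y` need not be that of `x`. Still `Y i ≥ Y j ≥ 0` for some `j` with `x j ≥ t`,
  -- while `x i ≤ t + ε` holds for every index.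
  have hsub : {x | t ≤ Finset.univ.sup' Finset.univ_nonempty x ∧
      Finset.univ.sup' Finset.univ_nonempty x ≤ t + ε} ⊆ ⋃ i, E i := by
    rintro x ⟨h1, h2⟩
    obtain ⟨i, hi⟩ := exists_mem_argmaxEvent Y x
    obtain ⟨j, -, hj⟩ := (Finset.le_sup'_iff _).1 h1
    have h3 : x i ≤ t + ε := (Finset.le_sup' x (Finset.mem_univ i)).trans h2
    refine Set.mem_iUnion.2 ⟨i, hi, ?_, ?_⟩
    · exact le_trans (mul_nonneg (inv_nonneg.2 (hσp j).le) (sub_nonneg.2 hj)) (hi j).1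
    · simp only [Y]
      rw [div_eq_inv_mul]
      exact mul_le_mul_of_nonneg_left (by linarith) (inv_nonneg.2 (hσp i).le)
  have hterm : ∀ k : Fin n, μ.real (E (Tuple.sort σ k)) ≤
      ε * (10 * M) * μ.real (argmaxEvent Y (Tuple.sort σ k))
        + ε * (1 / 2 * (1 / s₀)) * (((k : ℕ) + 1 : ℝ) ^ 2)⁻¹ := by
    intro k
    set i := Tuple.sort σ k with hi
    set h := -∫ x, Y i x ∂μ with hh
    set l := Real.log ((k : ℕ) + 1 : ℝ)
    have hl : 0 ≤ l := Real.log_nonneg (by simp)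
    have hδ : 0 ≤ ε / σ i := by have := hσp i; positivity
    have hp : 0 ≤ μ.real (argmaxEvent Y i) := measureReal_nonneg
    have hδ2 : ε / σ i ≤ ε / s₀ := div_le_div_of_nonneg_left hε.le hσ (orderedValue_zero_le σ i)
    -- Above the threshold, `exp (-h² / 2) ≤ exp (-2 l) = (k + 1)⁻²`. Below it, `h` is at most `3 /
    -- 2` times the `√(2 l)` of `weightMax`, and `9 / 2 * 3 / 2 = 27 / 4 ≤ 10`.
    rcases le_or_gt h (2 * √l) with hle | hgt
    · have h1 := measureReal_argmaxEvent_inter_le hY hG hYvar i hδ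
      rw [← hh] at h1
      have hMk : (1 + √(2 * l)) / σ i ≤ M := le_weightMax σ k
      have h2 : 2 * √l ≤ 3 / 2 * √(2 * l) := by
        rw [Real.sqrt_mul (by norm_num)]
        have : 4 / 3 ≤ √2 := Real.le_sqrt_of_sq_le (by norm_num)
        nlinarith [Real.sqrt_nonneg l]
      have h3 : 1 + max (h + ε / σ i) 0 ≤ 3 / 2 * (1 + √(2 * l)) := by
        have := max_le (a := h + ε / σ i) (b := 0) (c := 1 / 11 + 3 / 2 * √(2 * l))
          (by linarith) (by positivity)
        linarith
      have h4 : ε / σ i * (Real.exp (3 / 2) * (1 + max (h + ε / σ i) 0)) ≤ ε * (10 * M) := by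
        calc _ ≤ ε / σ i * (9 / 2 * (3 / 2 * (1 + √(2 * l)))) := by
              gcongr
              exact exp_three_halves_le
          _ = ε * (27 / 4 * ((1 + √(2 * l)) / σ i)) := by ring
          _ ≤ ε * (10 * M) := mul_le_mul_of_nonneg_left (by linarith) hε.le
      refine h1.trans ((mul_le_mul_of_nonneg_right h4 hp).trans ?_)
      have : 0 ≤ ε * (1 / 2 * (1 / s₀)) * (((k : ℕ) + 1 : ℝ) ^ 2)⁻¹ := by positivity
      linarith
    · have h0 : 0 ≤ h := le_trans (by positivity) hgt.le
      have h1 := measureReal_Icc_le_exp (hY i) (hG.eval i) (hYvar i) hδ (by linarith)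
      have h2 : Real.exp (-(∫ x, Y i x ∂μ) ^ 2 / 2) ≤ (((k : ℕ) + 1 : ℝ) ^ 2)⁻¹ := by
        have h5 : (∫ x, Y i x ∂μ) ^ 2 = h ^ 2 := by rw [hh, neg_sq]
        have h6 : 4 * l ≤ h ^ 2 := by
          have := pow_le_pow_left₀ (by positivity) hgt.le 2
          rwa [mul_pow, Real.sq_sqrt hl, show (2 : ℝ) ^ 2 = 4 by norm_num] at this
        have h7 : (((k : ℕ) + 1 : ℝ) ^ 2)⁻¹ = Real.exp (-(2 * l)) := by
          rw [Real.exp_neg, two_mul, Real.exp_add, Real.exp_log (by positivity), sq]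
        rw [h7, h5]
        gcongr
        linarith
      have h3 : μ.real (E i) ≤ ε * (1 / 2 * (1 / s₀)) * (((k : ℕ) + 1 : ℝ) ^ 2)⁻¹ := by
        calc μ.real (E i) ≤ μ.real {x | 0 ≤ Y i x ∧ Y i x ≤ ε / σ i} :=
              measureReal_mono Set.inter_subset_right
          _ ≤ _ := h1
          _ ≤ ε / s₀ * (1 / 2 * (((k : ℕ) + 1 : ℝ) ^ 2)⁻¹) := by gcongr
          _ = _ := by ring
      refine h3.trans ?_
      have : 0 ≤ ε * (10 * M) * μ.real (argmaxEvent Y i) := by positivity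
      linarith
  calc _ ≤ μ.real (⋃ i, E i) := measureReal_mono hsub
    _ ≤ ∑ i, μ.real (E i) := measureReal_iUnion_fintype_le _
    _ = ∑ k, μ.real (E (Tuple.sort σ k)) := (Equiv.sum_comp (Tuple.sort σ) _).symm
    _ ≤ ∑ k : Fin n, (ε * (10 * M) * μ.real (argmaxEvent Y (Tuple.sort σ k))
        + ε * (1 / 2 * (1 / s₀)) * (((k : ℕ) + 1 : ℝ) ^ 2)⁻¹) := Finset.sum_le_sum fun k _ ↦ hterm k
    _ = ε * (10 * M) * ∑ i, μ.real (argmaxEvent Y i)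
        + ε * (1 / 2 * (1 / s₀)) * ∑ k : Fin n, (((k : ℕ) + 1 : ℝ) ^ 2)⁻¹ := by
        rw [Finset.sum_add_distrib, ← Finset.mul_sum, ← Finset.mul_sum,
          Equiv.sum_comp (Tuple.sort σ) fun i ↦ μ.real (argmaxEvent Y i)]
    _ ≤ ε * (10 * M) * 1 + ε * (1 / 2 * (1 / s₀)) * 2 := by
        gcongr
        · exact sum_measureReal_argmaxEvent_le_one μ hY
        · exact sum_fin_inv_sq_le_two n
    _ ≤ _ := by
        have : 0 ≤ 1 / s₀ := by positivity
        nlinarith [mul_nonneg hε.le this, mul_nonneg hε.le hM0]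

/-! ### Assembly of the bounds -/

theorem mainTheorem11 {Ω : Type*} [MeasurableSpace Ω] (P : Measure Ω) [IsProbabilityMeasure P]
    (n : ℕ) [NeZero n] (X : Fin n → Ω → ℝ) (hX : IsGaussianProcess X P)
    (σ : Fin n → ℝ) (hσ_nonneg : ∀ i, 0 ≤ σ i) (hσ : ∀ i, variance (X i) P = σ i ^ 2) :
    (∀ ε : ℝ, 0 < ε →
      (ε / √12) / √(orderedValue σ ⊤ ^ 2 + ε ^ 2 / 12)
          ≤ concentrationFunction P (fieldMax X) ε ∧
      concentrationFunction P (fieldMax X) ε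
          ≤ 12 * (2 + √(2 * Real.log n)) * ε /
            √(sigmaBar σ ^ 2 + (2 + √(2 * Real.log n)) ^ 2 * ε ^ 2)) ∧
    orderedValue σ 0 ≤ sigmaBar σ := by
  have hG := hasGaussianLaw_pi_of_isGaussianProcess hX
  have hμ := hG.isGaussian_map
  set A := 2 + √(2 * Real.log n) with hA_def
  have hA : 0 < A := by positivity
  set s₀ := orderedValue σ 0 with hs₀
  have hs₀0 : 0 ≤ s₀ := hσ_nonneg _
  have hbar : s₀ ≠ 0 → sigmaBar σ = A / (1 / s₀ + weightMax σ) := fun h ↦ if_neg h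
  have hbar0 : s₀ = 0 → sigmaBar σ = 0 := fun h ↦ if_pos h
  refine ⟨fun ε hε ↦ ⟨?_, ?_⟩, ?_⟩
  · have hmem : MemLp (fieldMax X) 2 P := by
      have h1 := lipschitzWith_finset_sup' (n := n).memLp_of_isGaussian (P.map fun ω i ↦ X i ω)
      exact h1.comp_of_map hG.aemeasurable
    refine div_sqrt_le_concentrationFunction hmem hε ?_
    refine variance_sup'_le hG (hσ_nonneg _) fun i ↦ ?_
    rw [hσ]
    exact pow_le_pow_left₀ (hσ_nonneg i) (le_orderedValue_top σ i) 2
  · refine ciSup_le fun t ↦ ?_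
    have hQ1 : P.real {ω | t ≤ fieldMax X ω ∧ fieldMax X ω ≤ t + ε} ≤ 1 := measureReal_le_one
    rcases hs₀0.eq_or_lt with h0 | h0
    -- Here the right-hand side is the constant `12`, so the bound is trivial.
    · rw [hbar0 h0.symm]
      have : √(0 ^ 2 + A ^ 2 * ε ^ 2) = A * ε := by
        rw [← mul_pow, zero_pow two_ne_zero, zero_add, Real.sqrt_sq (by positivity)]
      rw [this, mul_assoc, mul_div_assoc, div_self (by positivity)]
      linarith
    · set D := 1 / s₀ + weightMax σ with hD
      have hw : 1 / s₀ ≤ weightMax σ := one_div_orderedValue_zero_le_weightMax σ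
      have hs₀1 : 0 < 1 / s₀ := by positivity
      have hD0 : 0 < D := by linarith
      have hεD : 0 < ε * D := by positivity
      have hR : 12 * A * ε / √(sigmaBar σ ^ 2 + A ^ 2 * ε ^ 2)
          = 12 * (ε * D) / √(1 + (ε * D) ^ 2) := by
        have h1 : sigmaBar σ ^ 2 + A ^ 2 * ε ^ 2 = (A / D) ^ 2 * (1 + (ε * D) ^ 2) := by
          rw [hbar h0.ne']
          field_simp
        rw [h1, Real.sqrt_mul (by positivity), Real.sqrt_sq (by positivity)]
        field_simp
      rw [hR, le_div_iff₀ (by positivity)]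
      -- Up to `1 / 11` the square root is at most `12 / 11`, turning the constant `11` into `12`;
      -- beyond it the right-hand side already exceeds `1`.
      rcases le_or_gt (ε * D) (1 / 11) with hsm | hlg
      · have hε2 : ε / s₀ ≤ 1 / 11 := by
          rw [div_eq_mul_one_div]
          exact (mul_le_mul_of_nonneg_left (by linarith) hε.le).trans hsm
        have hvar : ∀ i, Var[fun x : Fin n → ℝ ↦ x i; P.map fun ω i ↦ X i ω] = σ i ^ 2 := by
          intro i
          rw [variance_map (measurable_pi_apply i).aemeasurable hG.aemeasurable, ← hσ]
          rfl
        have hb := measureReal_sup'_mem_Icc_le h0 hvar hε hε2 t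
        have hm : Measurable fun x : Fin n → ℝ ↦ Finset.univ.sup' Finset.univ_nonempty x :=
          lipschitzWith_finset_sup'.continuous.measurable
        have hset : MeasurableSet {x : Fin n → ℝ | t ≤ Finset.univ.sup' Finset.univ_nonempty x ∧
            Finset.univ.sup' Finset.univ_nonempty x ≤ t + ε} := hm measurableSet_Icc
        rw [measureReal_def, Measure.map_apply_of_aemeasurable hG.aemeasurable hset] at hb
        have hsq : √(1 + (ε * D) ^ 2) ≤ 12 / 11 := by
          refine Real.sqrt_le_iff.2 ⟨by norm_num, ?_⟩
          nlinarith
        calc _ ≤ 11 * (ε * D) * (12 / 11) := by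
              gcongr
              exact hb
          _ = _ := by ring
      · have hsq : √(1 + (ε * D) ^ 2) ≤ 12 * (ε * D) := by
          refine Real.sqrt_le_iff.2 ⟨by positivity, ?_⟩
          nlinarith
        exact (mul_le_of_le_one_left (Real.sqrt_nonneg _) hQ1).trans hsq
  · rcases hs₀0.eq_or_lt with h0 | h0
    · rw [← h0, hbar0 h0.symm]
    · have hw : weightMax σ ≤ (1 + √(2 * Real.log n)) / s₀ := by
        refine Finset.sup'_le _ _ fun k _ ↦ ?_
        have h1 : s₀ ≤ orderedValue σ k := orderedValue_zero_le σ _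
        have h2 : ((k : ℕ) + 1 : ℝ) ≤ n := by exact_mod_cast k.isLt
        gcongr
      have hw0 : 1 / s₀ ≤ weightMax σ := one_div_orderedValue_zero_le_weightMax σ
      have hs₀1 : 0 < 1 / s₀ := by positivity
      rw [hbar h0.ne', le_div_iff₀ (by linarith)]
      calc s₀ * (1 / s₀ + weightMax σ) ≤ s₀ * (1 / s₀ + (1 + √(2 * Real.log n)) / s₀) := by gcongr
        _ = A := by
          field_simp
          ring
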